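/- **Conventions.** Partitions are identified with their Ferrers diagrams; rows are numbered downwards, and for partitions $\kappa\subsetneq\rho$, $D=\rho/\kappa$ is the skew diagram. The length of a row is its number of boxes, and the last row of a diagram is its lowest (nonempty) row. $s_D=\sum_T x^T$, summed over the semistandard Young tableaux $T$ of shape $D$, is the skew Schur function of $D$, and $c^{\rho}_{\kappa\nu}$ are the Littlewood–Richardson coefficients, $s_\kappa s_\nu=\sum_\rho c^{\rho}_{\kappa\nu}s_\rho$. Write $f\ge_s 0$ if $f$ is a linear combination of Schur functions $s_\nu$ ($\nu$ a partition) with nonnegative coefficients, and $f\ge_s g$ if $f-g\ge_s 0$. For a composition $\alpha=(\alpha_1,\dots,\alpha_n)$ (positive integers) let $\delta_\alpha$ be the partition $(n^{\alpha_n},(n-1)^{\alpha_{n-1}},\dots,1^{\alpha_1})$ and $\Delta_\alpha$ its rotation by $180^\circ$. A partition $\nu$ is a fat staircase if $\nu=\delta_\alpha$ for some composition $\alpha$; then $\alpha(\nu)$ denotes this $\alpha$, i.e. $\alpha(\nu)_i$ is the number of parts of $\nu$ equal to $i$. For a diagram $D$, a partition $\lambda$ and $k\ge 0$ with $\lambda_1-k\le$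 the length of the last row of $D$, let $\mathcal S(\lambda,D;k)$ be the diagram obtained by placing $\lambda$ immediately below $D$ so that the first row of $\lambda$ begins exactly one box below and $k$ boxes to the left of the leftmost box of the last row of $D$. Put $\mathcal S(\lambda,\alpha^{\triangleleft};k)=\mathcal S(\lambda,\Delta_\alpha;k)$, and let $\lambda^t$ be the conjugate of $\lambda$. **Theorem.** Let $D=\rho/\kappa$ be a nonempty skew diagram that is a sum of fat staircases, i.e. $$s_D=\sum_{\nu}c^{\rho}_{\kappa\nu}\,s_\nu ,$$ where here and below $\nu$ runs over the fat staircases with $|\nu|=|\rho|-|\kappa|$. Let $\lambda$ be a partition with exactly one part, such that $\lambda_1-1\le$ the length of the last row of $D$. Then $$s_{\mathcal S(\lambda^t,D;1)}-s_{\mathcal S(\lambda,D;1)}\ \ge_s\ \sum_{\nu}c^{\rho}_{\kappa\nu}\bigl(s_{\mathcal S(\lambda^t,\alpha(\nu)^{\triangleleft};1)}-s_{\mathcal S(\lambda,\alpha(\nu)^{\triangleleft};1)}\bigr)\ \ge_s\ 0 .$$ Moreover, $$s_{\mathcal S(\lambda^t,D;1)}=\sum_{\nu}c^{\rho}_{\kappa\nu}\,s_{\mathcal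 S(\lambda^t,\alpha(\nu)^{\triangleleft};1)} .$$ -/

import Mathlib

/-!
# Skew Schur functions, fat staircases, and diagrams with a foundation

A diagram is a finite set of boxes in the plane. The box `(r, c)` is in row `r` and column `c`;
rows are numbered downwards and columns are numbered to the right. Coordinates are integers, so
that diagrams can be translated and rotated freely. Partitions are Mathlib's `YoungDiagram`s, whose
rows and columns are numbered from `0`.
-/

namespace FatStair

noncomputable section

/-- A diagram: a finite set of boxes `(row, column)`. -/
abbrev Diagram := Finset (ℤ × ℤ)

/-! ### Diagrams -/

/-- The Ferrers diagram of a partition. -/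
def ferrers (μ : YoungDiagram) : Diagram :=
  μ.cells.image (fun p => ((p.1 : ℤ), (p.2 : ℤ)))

/-- The skew diagram `ρ / κ` (used for `κ ⊆ ρ`). -/
def skew (ρ κ : YoungDiagram) : Diagram := ferrers ρ \ ferrers κ

/-- The rotation of a diagram by 180 degrees. -/
def rotate (D : Diagram) : Diagram := D.image (fun p => (-p.1, -p.2))

/-- The index of the last (lowest) row of `D` that contains a box; `0` if `D` is empty. -/
def lastRow (D : Diagram) : ℤ := (D.image Prod.fst).max.unbotD 0

/-- The length of the last row of `D`. -/
def lastRowLength (D : Diagram) : ℕ := (D.filter (fun p => p.1 = lastRow D)).card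

/-- The column of the leftmost box of the last row of `D`; `0` if `D` is empty. -/
def lastRowStart (D : Diagram) : ℤ :=
  ((D.filter (fun p => p.1 = lastRow D)).image Prod.snd).min.untopD 0

/-- The diagram `S(lam, D; k)`: the Ferrers diagram of `lam` is placed immediately below `D`, its
first row beginning one box below and `k` boxes to the left of the first box of the last row
of `D`. -/
def withFoundation (lam : YoungDiagram) (D : Diagram) (k : ℕ) : Diagram :=
  D ∪ (ferrers lam).image (fun p => (lastRow D + 1 + p.1, lastRowStart D - k + p.2))

/-! ### Tableaux and skew Schur functions -/

/-- A semistandard Young tableau of shape `D`: rows weakly increase and columns strictly increase.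
The entry `i : ℕ` stands for the positive integer `i + 1`. -/
@[ext]
structure SSYT (D : Diagram) where
  entry : D → ℕ
  row_weak : ∀ p q : D, p.1.1 = q.1.1 → p.1.2 < q.1.2 → entry p ≤ entry q
  col_strict : ∀ p q : D, p.1.2 = q.1.2 → p.1.1 < q.1.1 → entry p < entry q

/-- The content of a tableau: for each entry, the number of its occurrences. -/
def SSYT.content {D : Diagram} (T : SSYT D) : ℕ →₀ ℕ :=
  ∑ p : D, Finsupp.single (T.entry p) 1

/-- There are only finitely many tableaux of given shape and content, so that the numbers in the
next definition are honest cardinalities. -/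
theorem finite_ssyt_content (D : Diagram) (m : ℕ →₀ ℕ) :
    Finite {T : SSYT D // T.content = m} := by
  classical
  have key : ∀ (T : {T : SSYT D // T.content = m}) (p : D), T.1.entry p ∈ m.support := by
    intro T p
    rw [Finsupp.mem_support_iff]
    intro h
    have hT : T.1.content (T.1.entry p) = 0 := by rw [T.2]; exact h
    rw [SSYT.content, Finsupp.finsetSum_apply] at hT
    have := Finset.sum_eq_zero_iff.1 hT p (Finset.mem_univ p)
    simp at this
  refine Finite.of_injective
    (fun (T : {T : SSYT D // T.content = m}) (p : D) => (⟨T.1.entry p, key T p⟩ : m.support)) ?_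
  intro T T' h
  apply Subtype.ext
  apply SSYT.ext
  funext p
  exact congrArg Subtype.val (congrFun h p)

/-- The skew Schur function of a diagram, `s_D = ∑_T x^T` over all semistandard tableaux `T` of
shape `D`, as a formal power series in infinitely many variables: the coefficient of the monomial
`x^m` is the number of tableaux of content `m`. The variable with index `i` stands
for `x_{i+1}`. -/
def skewSchur (D : Diagram) : MvPowerSeries ℕ ℤ :=
  fun m => (Nat.card {T : SSYT D // T.content = m} : ℤ)

/-- The Schur function of a partition. -/
def schur (ν : YoungDiagram) : MvPowerSeries ℕ ℤ := skewSchur (ferrers ν)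

/-- The finite integral linear combination `∑_ν a_ν s_ν` of Schur functions. -/
def schurSum (a : YoungDiagram →₀ ℤ) : MvPowerSeries ℕ ℤ := a.sum (fun ν c => c • schur ν)

/-- `f` is Schur-positive: it is a linear combination of Schur functions with nonnegative
coefficients. -/
def SchurPositive (f : MvPowerSeries ℕ ℤ) : Prop :=
  ∃ a : YoungDiagram →₀ ℤ, f = schurSum a ∧ ∀ ν, 0 ≤ a ν

/-- `f ≥_s g`: the difference `f - g` is Schur-positive. -/
def SchurGE (f g : MvPowerSeries ℕ ℤ) : Prop := SchurPositive (f - g)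

open Classical in
/-- The coefficient `[s_ν](f)` of `s_ν` in the expansion of a symmetric function `f` in the basis of
Schur functions. -/
def schurCoeff (ν : YoungDiagram) (f : MvPowerSeries ℕ ℤ) : ℤ :=
  if h : ∃ a : YoungDiagram →₀ ℤ, f = schurSum a then h.choose ν else 0

/-- The Littlewood-Richardson coefficient `c^ρ_{κν}`, the structure constant in
`s_κ s_ν = ∑_ρ c^ρ_{κν} s_ρ`. -/
def lrCoeff (ρ κ ν : YoungDiagram) : ℤ := schurCoeff ρ (schur κ * schur ν)

/-! ### Fat staircases

A composition `α = (α_1, …, α_n)` is a list of positive integers. -/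

/-- The row lengths `(n^{α_n}, …, 2^{α_2}, 1^{α_1})` of the fat staircase `δ_α`. -/
def deltaRows (α : List ℕ) : List ℕ :=
  (List.range α.length).reverse.flatMap (fun i => List.replicate (α.getD i 0) (i + 1))

theorem deltaRows_sorted (α : List ℕ) : (deltaRows α).SortedGE := by
  apply List.Pairwise.sortedGE
  rw [deltaRows, List.pairwise_flatMap]
  constructor
  · intro i _
    simp [List.pairwise_replicate]
  · rw [List.pairwise_reverse]
    refine List.pairwise_lt_range.imp ?_
    intro i j hij x hx y hy
    rw [List.mem_replicate] at hx hy
    omega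

/-- The partition `δ_α = (n^{α_n}, …, 2^{α_2}, 1^{α_1})`. -/
def delta (α : List ℕ) : YoungDiagram := YoungDiagram.ofRowLens (deltaRows α) (deltaRows_sorted α)

/-- The diagram `Δ_α`, the rotation of `δ_α` by 180 degrees. -/
def Delta (α : List ℕ) : Diagram := rotate (ferrers (delta α))

/-- The partition `ν` is a fat staircase: `ν = δ_α` for a composition `α`. -/
def IsFatStaircase (ν : YoungDiagram) : Prop :=
  ∃ α : List ℕ, (∀ a ∈ α, 0 < a) ∧ ν = delta α

/-- For a fat staircase `ν`, the composition `α(ν)` with `δ_{α(ν)} = ν`: its `i`-th part is the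
number of parts of `ν` equal to `i`, for `i = 1, …, ν_1`. -/
def alpha (ν : YoungDiagram) : List ℕ :=
  (List.range (ν.rowLen 0)).map (fun i => ν.rowLens.count (i + 1))

theorem finite_card_eq (n : ℕ) : {ν : YoungDiagram | ν.card = n}.Finite := by
  have hsub : ∀ ν : YoungDiagram, ν.card = n →
      ν.cells ⊆ Finset.range n ×ˢ Finset.range n := by
    rintro ν hν ⟨i, j⟩ hij
    have h1 : (Finset.range (i + 1) ×ˢ Finset.range (j + 1)) ⊆ ν.cells := by
      rintro ⟨a, b⟩ hab
      simp only [Finset.mem_product, Finset.mem_range] at hab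
      exact ν.up_left_mem (by omega) (by omega) hij
    have h2 := Finset.card_le_card h1
    rw [Finset.card_product, Finset.card_range, Finset.card_range] at h2
    have h3 : (i + 1) * (j + 1) ≤ n := hν ▸ h2
    simp only [Finset.mem_product, Finset.mem_range]
    constructor <;> nlinarith
  have hfin : ((↑((Finset.range n ×ˢ Finset.range n).powerset) :
      Set (Finset (ℕ × ℕ)))).Finite := Finset.finite_toSet _
  refine (hfin.preimage (f := YoungDiagram.cells) ?_).subset ?_
  · intro μ _ ν _ h
    exact YoungDiagram.ext h
  · intro ν hν
    exact Finset.mem_coe.2 (Finset.mem_powerset.2 (hsub ν hν))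

open Classical in
/-- The finite set of all partitions of `n` that are fat staircases. -/
def fatStaircases (n : ℕ) : Finset YoungDiagram :=
  (finite_card_eq n).toFinset.filter IsFatStaircase

/-- The diagram `D = ρ / κ` is a sum of fat staircases: `s_D = ∑_ν c^ρ_{κν} s_ν`, where `ν` runs
over the fat staircases (with as many boxes as `D`). -/
def IsSumOfFatStaircases (ρ κ : YoungDiagram) : Prop :=
  skewSchur (skew ρ κ) = ∑ ν ∈ fatStaircases (skew ρ κ).card, lrCoeff ρ κ ν • schur ν

end

end FatStair

/-! Everything is compared coefficient by coefficient in the Schur basis. By the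
Littlewood–Richardson rule (`skewSchur_eq_sum_lrNum`), the coefficient of s_μ in a skew Schur
function counts lattice tableaux of content μ. Such a tableau on D with a foundation of m boxes
restricts to a lattice tableau on D, of some content ν. The question is which pairs (μ, ν) occur,
and how often.

For a column, the foundation shares no row or column with D. The column can be filled precisely when
μ/ν is a vertical strip, and then in one way (`lrNum_attach_colBox`). The answer depends on D only
through the coefficients of s_D, which gives the final identity.

For a row, the lattice condition forces μ_{k+1} ≤ ν_k (`SSYT.IsLR.wt_succ_le_wt_restrict`). Rows of
a fat staircase drop by at most one, so μ_{k+1} ≤ ν_k ≤ ν_{k+1} + 1. Hence μ/ν has at most one box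
in each row and in each column, a double strip. As the filling of the row is determined by μ and ν,
this bounds the coefficient from above (`lrNum_attach_rowBox_le`). On the rotation of ν there is
just one lattice tableau, its content is ν, and every double strip is realized
(`lrNum_attach_rowBox_pos`); there the bound is sharp.

So the middle expression of the theorem counts, with weights c^ρ_{κν} ≥ 0, the vertical strips that
are not double strips, and is Schur-positive. Passing from the Δ_{α(ν)} to D preserves the column
terms and can only lower the row term, which is the first inequality.

The rule itself comes from multiplying by the alternant of the staircase and cancelling non-lattice
tableaux in pairs by a partial Bender–Knuth involution. The c^ρ_{κν} are matched with tableau counts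
only through the hypothesis on D and linear independence of Schur functions
(`IsSumOfFatStaircases.lrNum_eq`). -/

namespace FatStair

noncomputable section

/-! ### Tableaux as functions on the plane -/

/-- The entry of a tableau in a box, extended by `0` outside of its shape. -/
def SSYT.val {D : Diagram} (T : SSYT D) (p : ℤ × ℤ) : ℕ :=
  if h : p ∈ D then T.entry ⟨p, h⟩ else 0

theorem SSYT.val_of_mem {D : Diagram} (T : SSYT D) {p : ℤ × ℤ} (h : p ∈ D) :
    T.val p = T.entry ⟨p, h⟩ := dif_pos h

theorem SSYT.val_row {D : Diagram} (T : SSYT D) {r x y : ℤ} (hx : (r, x) ∈ D) (hy : (r, y) ∈ D)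
    (h : x ≤ y) : T.val (r, x) ≤ T.val (r, y) := by
  rcases h.eq_or_lt with rfl | h
  · exact le_rfl
  · rw [T.val_of_mem hx, T.val_of_mem hy]
    exact T.row_weak ⟨_, hx⟩ ⟨_, hy⟩ rfl h

theorem SSYT.val_col {D : Diagram} (T : SSYT D) {r s x : ℤ} (hr : (r, x) ∈ D) (hs : (s, x) ∈ D)
    (h : r < s) : T.val (r, x) < T.val (s, x) := by
  rw [T.val_of_mem hr, T.val_of_mem hs]
  exact T.col_strict ⟨_, hr⟩ ⟨_, hs⟩ rfl h

theorem SSYT.row_eq_of_val_eq {D : Diagram} (T : SSYT D) {r s x : ℤ} (hr : (r, x) ∈ D)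
    (hs : (s, x) ∈ D) (h : T.val (r, x) = T.val (s, x)) : r = s := by
  rcases lt_trichotomy r s with h1 | h1 | h1
  · have := T.val_col hr hs h1; omega
  · exact h1
  · have := T.val_col hs hr h1; omega

theorem SSYT.ext_val {D : Diagram} {T T' : SSYT D} (h : ∀ p ∈ D, T.val p = T'.val p) : T = T' := by
  apply SSYT.ext
  funext p
  have := h p.1 p.2
  rwa [T.val_of_mem p.2, T'.val_of_mem p.2] at this

/-- The tableau of shape `D` with entries given by a function on the plane. -/
def SSYT.ofFun {D : Diagram} (f : ℤ × ℤ → ℕ)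
    (hr : ∀ r x y, (r, x) ∈ D → (r, y) ∈ D → x < y → f (r, x) ≤ f (r, y))
    (hc : ∀ r s x, (r, x) ∈ D → (s, x) ∈ D → r < s → f (r, x) < f (s, x)) : SSYT D where
  entry p := f p.1
  row_weak := by
    rintro ⟨⟨r, x⟩, hp⟩ ⟨⟨s, y⟩, hq⟩ h h'
    obtain rfl : r = s := h
    exact hr _ _ _ hp hq h'
  col_strict := by
    rintro ⟨⟨r, x⟩, hp⟩ ⟨⟨s, y⟩, hq⟩ h h'
    obtain rfl : x = y := h
    exact hc _ _ _ hp hq h'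

theorem SSYT.val_ofFun {D : Diagram} {f : ℤ × ℤ → ℕ} {hr hc} {p : ℤ × ℤ} (hp : p ∈ D) :
    (SSYT.ofFun (D := D) f hr hc).val p = f p := by
  rw [SSYT.val_of_mem _ hp]; rfl

/-- The number of entries `k` of a tableau. -/
def SSYT.wt {D : Diagram} (T : SSYT D) (k : ℕ) : ℕ := (D.filter (fun p => T.val p = k)).card

/-- The number of entries `k` of a tableau in the columns from `c` on. -/
def SSYT.cnt {D : Diagram} (T : SSYT D) (c : ℤ) (k : ℕ) : ℕ :=
  (D.filter (fun p => c ≤ p.2 ∧ T.val p = k)).card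

/-- The number of entries `k` of a tableau in the columns before `c`. -/
def SSYT.cntLT {D : Diagram} (T : SSYT D) (c : ℤ) (k : ℕ) : ℕ :=
  (D.filter (fun p => p.2 < c ∧ T.val p = k)).card

/-- The lattice condition: for every column `c`, the content of the part of the tableau in the
columns from `c` on is a partition. -/
def SSYT.IsLR {D : Diagram} (T : SSYT D) : Prop := ∀ c k, T.cnt c (k + 1) ≤ T.cnt c k

/-! ### Counting entries by columns -/

theorem SSYT.wt_eq_cntLT_add_cnt {D : Diagram} (T : SSYT D) (c : ℤ) (k : ℕ) :
    T.wt k = T.cntLT c k + T.cnt c k := by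
  rw [SSYT.wt, SSYT.cnt, SSYT.cntLT, ← Finset.card_union_of_disjoint]
  · congr 1
    ext p
    simp only [Finset.mem_filter, Finset.mem_union]
    have := lt_or_ge p.2 c
    tauto
  · rw [Finset.disjoint_left]
    intro p hp hq
    simp only [Finset.mem_filter] at hp hq
    omega

theorem exists_lower_col (D : Diagram) : ∃ c : ℤ, ∀ p ∈ D, c ≤ p.2 := by
  obtain ⟨c, hc⟩ := (D.image Prod.snd).bddBelow
  exact ⟨c, fun p hp => hc (by simpa using ⟨p.1, hp⟩)⟩

theorem exists_upper_col (D : Diagram) : ∃ c : ℤ, ∀ p ∈ D, p.2 < c := by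
  obtain ⟨c, hc⟩ := (D.image Prod.snd).bddAbove
  exact ⟨c + 1, fun p hp => Int.lt_add_one_of_le (hc (by simpa using ⟨p.1, hp⟩))⟩

theorem SSYT.cnt_eq_wt {D : Diagram} (T : SSYT D) {c : ℤ} (hc : ∀ p ∈ D, c ≤ p.2) (k : ℕ) :
    T.cnt c k = T.wt k := by
  rw [SSYT.cnt, SSYT.wt]
  congr 1
  exact Finset.filter_congr fun p hp => by simp [hc p hp]

theorem SSYT.cntLT_eq_wt {D : Diagram} (T : SSYT D) {c : ℤ} (hc : ∀ p ∈ D, p.2 < c) (k : ℕ) :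
    T.cntLT c k = T.wt k := by
  rw [SSYT.cntLT, SSYT.wt]
  congr 1
  exact Finset.filter_congr fun p hp => by simp [hc p hp]

theorem SSYT.cnt_eq_zero {D : Diagram} (T : SSYT D) {c : ℤ} (hc : ∀ p ∈ D, p.2 < c) (k : ℕ) :
    T.cnt c k = 0 := by
  rw [SSYT.cnt, Finset.card_eq_zero, Finset.filter_eq_empty_iff]
  intro p hp h
  have := hc p hp
  omega

theorem SSYT.IsLR.wt_antitone {D : Diagram} {T : SSYT D} (h : T.IsLR) : Antitone T.wt := by
  obtain ⟨c, hc⟩ := exists_lower_col D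
  apply antitone_nat_of_succ_le
  intro k
  rw [← T.cnt_eq_wt hc, ← T.cnt_eq_wt hc]
  exact h c k

theorem SSYT.content_apply {D : Diagram} (T : SSYT D) (k : ℕ) : T.content k = T.wt k := by
  rw [SSYT.content, Finsupp.finsetSum_apply, SSYT.wt, Finset.card_filter, ← Finset.sum_coe_sort D]
  refine Finset.sum_congr rfl fun p _ => ?_
  rw [T.val_of_mem p.2, Finsupp.single_apply]

theorem SSYT.sum_wt {D : Diagram} (T : SSYT D) {n : ℕ} (h : ∀ p ∈ D, T.val p < n) :
    ∑ k ∈ Finset.range n, T.wt k = D.card :=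
  (Finset.card_eq_sum_card_fiberwise fun p hp => by simpa using h p hp).symm

theorem SSYT.wt_val_pos {D : Diagram} (T : SSYT D) {p : ℤ × ℤ} (hp : p ∈ D) : 0 < T.wt (T.val p) :=
  Finset.card_pos.2 ⟨p, by simp [hp]⟩

theorem SSYT.wt_eq_zero {D : Diagram} (T : SSYT D) {k n : ℕ} (h : ∀ p ∈ D, T.val p < n)
    (hk : n ≤ k) : T.wt k = 0 := by
  rw [SSYT.wt, Finset.card_eq_zero, Finset.filter_eq_empty_iff]
  intro p hp h'
  have := h p hp
  omega

/-- The entries of a lattice tableau are smaller than its number of boxes. -/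
theorem SSYT.IsLR.val_lt_card {D : Diagram} {T : SSYT D} (h : T.IsLR) {p : ℤ × ℤ} (hp : p ∈ D) :
    T.val p < D.card := by
  have hpos := T.wt_val_pos hp
  obtain ⟨n, hn⟩ : ∃ n, ∀ q ∈ D, T.val q < n := by
    obtain ⟨n, hn⟩ := (D.image T.val).bddAbove
    exact ⟨n + 1, fun q hq => Nat.lt_succ_of_le (hn (by
      simp only [Finset.coe_image, Set.mem_image, Finset.mem_coe]; exact ⟨q, hq, rfl⟩))⟩
  -- Multiplicities decrease weakly, so each of the values 0, …, `T.val p` occurs at least once.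
  rw [← T.sum_wt hn]
  have hpn := hn p hp
  calc T.val p < T.val p + 1 := Nat.lt_succ_self _
    _ = ∑ k ∈ Finset.range (T.val p + 1), 1 := by simp
    _ ≤ ∑ k ∈ Finset.range (T.val p + 1), T.wt k := Finset.sum_le_sum fun k hk => by
        have := h.wt_antitone (Nat.lt_succ_iff.1 (Finset.mem_range.1 hk))
        omega
    _ ≤ _ := Finset.sum_le_sum_of_subset (by simpa using hpn)

/-! ### Bender-Knuth involutions -/

/-- Reversing the free boxes of a row and exchanging k with k + 1 turns k^a (k+1)^b into k^b (k+1)^a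
without having to name a and b. This is the form in which the Bender–Knuth involution is set up. -/
theorem exists_antitone_involution (G : Finset ℤ) :
    ∃ f : ℤ → ℤ, (∀ x ∈ G, f x ∈ G) ∧ (∀ x ∈ G, f (f x) = x) ∧
      ∀ x ∈ G, ∀ y ∈ G, x < y → f y < f x := by
  classical
  let e := G.orderIsoOfFin rfl
  let g : G → G := fun x => e (Fin.rev (e.symm x))
  have hg : ∀ x, g (g x) = x := fun x => by simp [g]
  have hanti : ∀ x y, x < y → g y < g x := fun x y h => by simpa [g] using h
  refine ⟨fun x => if h : x ∈ G then g ⟨x, h⟩ else x, ?_, ?_, ?_⟩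
  · intro x hx
    simp [hx]
  · intro x hx
    simp [hx, hg]
  · intro x hx y hy h
    simp only [hx, hy, dif_pos]
    exact hanti ⟨x, hx⟩ ⟨y, hy⟩ h

/-- Every finite set of boxes admits an involution that reverses each of its rows. -/
theorem exists_rowReversal (F : Diagram) :
    ∃ f : ℤ × ℤ → ℤ × ℤ, (∀ p ∈ F, f p ∈ F) ∧ (∀ p ∈ F, f (f p) = p) ∧
      (∀ p, (f p).1 = p.1) ∧
      ∀ r x y, (r, x) ∈ F → (r, y) ∈ F → x < y → (f (r, y)).2 < (f (r, x)).2 := by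
  classical
  choose f hf using fun r : ℤ => exists_antitone_involution ((F.filter (fun p => p.1 = r)).image Prod.snd)
  have hm : ∀ r x, x ∈ (F.filter (fun p => p.1 = r)).image Prod.snd ↔ (r, x) ∈ F := by
    intro r x
    simp only [Finset.mem_image, Finset.mem_filter]
    constructor
    · rintro ⟨⟨a, b⟩, ⟨h, rfl⟩, rfl⟩; exact h
    · intro h; exact ⟨_, ⟨h, rfl⟩, rfl⟩
  simp only [hm] at hf
  refine ⟨fun p => (p.1, f p.1 p.2), ?_, ?_, ?_, ?_⟩
  · rintro ⟨r, x⟩ h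
    exact (hf r).1 x h
  · rintro ⟨r, x⟩ h
    simp only [(hf r).2.1 x h]
  · intro p; rfl
  · intro r x y hx hy h
    exact (hf r).2.2 x hx y hy h

/-- A chosen involution that reverses each row of a finite set of boxes. -/
def rowReversal (F : Diagram) : ℤ × ℤ → ℤ × ℤ := (exists_rowReversal F).choose

theorem rowReversal_mem {F : Diagram} {p : ℤ × ℤ} (hp : p ∈ F) : rowReversal F p ∈ F :=
  (exists_rowReversal F).choose_spec.1 p hp

theorem rowReversal_rowReversal {F : Diagram} {p : ℤ × ℤ} (hp : p ∈ F) :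
    rowReversal F (rowReversal F p) = p :=
  (exists_rowReversal F).choose_spec.2.1 p hp

theorem rowReversal_fst (F : Diagram) (p : ℤ × ℤ) : (rowReversal F p).1 = p.1 :=
  (exists_rowReversal F).choose_spec.2.2.1 p

theorem rowReversal_snd {F : Diagram} {r x y : ℤ} (hx : (r, x) ∈ F) (hy : (r, y) ∈ F)
    (h : x < y) : (rowReversal F (r, y)).2 < (rowReversal F (r, x)).2 :=
  (exists_rowReversal F).choose_spec.2.2.2 r x y hx hy h

/-- The boxes of `D` in the columns before `j` that contain `k` or `k + 1` and share their column
with no other such box. -/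
def freeBoxes (D : Diagram) (f : ℤ × ℤ → ℕ) (k : ℕ) (j : ℤ) : Diagram :=
  D.filter (fun p => p.2 < j ∧ (f p = k ∨ f p = k + 1) ∧
    ∀ q ∈ D, q.2 = p.2 → (f q = k ∨ f q = k + 1) → q = p)

theorem mem_freeBoxes {D : Diagram} {f : ℤ × ℤ → ℕ} {k : ℕ} {j : ℤ} {p : ℤ × ℤ} :
    p ∈ freeBoxes D f k j ↔ p ∈ D ∧ p.2 < j ∧ (f p = k ∨ f p = k + 1) ∧
      ∀ q ∈ D, q.2 = p.2 → (f q = k ∨ f q = k + 1) → q = p := by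
  simp [freeBoxes]

open Classical in
/-- The values of the Bender-Knuth involution that acts on the entries `k` and `k + 1` in the
columns before `j`. -/
def bkFun (D : Diagram) (f : ℤ × ℤ → ℕ) (k : ℕ) (j : ℤ) (p : ℤ × ℤ) : ℕ :=
  if p ∈ freeBoxes D f k j then 2 * k + 1 - f (rowReversal (freeBoxes D f k j) p) else f p

theorem bkFun_of_notMem {D : Diagram} {f : ℤ × ℤ → ℕ} {k : ℕ} {j : ℤ} {p : ℤ × ℤ}
    (h : p ∉ freeBoxes D f k j) : bkFun D f k j p = f p := if_neg h

theorem bkFun_of_mem {D : Diagram} {f : ℤ × ℤ → ℕ} {k : ℕ} {j : ℤ} {p : ℤ × ℤ}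
    (h : p ∈ freeBoxes D f k j) :
    bkFun D f k j p = 2 * k + 1 - f (rowReversal (freeBoxes D f k j) p) := if_pos h

theorem bkFun_of_le {D : Diagram} {f : ℤ × ℤ → ℕ} {k : ℕ} {j : ℤ} {p : ℤ × ℤ} (h : j ≤ p.2) :
    bkFun D f k j p = f p := by
  apply bkFun_of_notMem
  rw [mem_freeBoxes]
  omega

/-- Freeness depends only on where the entries k and k + 1 together are, a set which the move
preserves. Hence the free boxes are the same before and after, and the move is an involution. -/
theorem freeBoxes_congr {D : Diagram} {f g : ℤ × ℤ → ℕ} {k : ℕ} {j : ℤ}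
    (h : ∀ p ∈ D, p.2 < j → ((f p = k ∨ f p = k + 1) ↔ (g p = k ∨ g p = k + 1))) :
    freeBoxes D f k j = freeBoxes D g k j := by
  ext p
  rw [mem_freeBoxes, mem_freeBoxes]
  constructor
  · rintro ⟨h1, h2, h3, h4⟩
    exact ⟨h1, h2, (h p h1 h2).1 h3, fun q hq hqp hq' => h4 q hq hqp ((h q hq (hqp ▸ h2)).2 hq')⟩
  · rintro ⟨h1, h2, h3, h4⟩
    exact ⟨h1, h2, (h p h1 h2).2 h3, fun q hq hqp hq' => h4 q hq hqp ((h q hq (hqp ▸ h2)).1 hq')⟩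

theorem bkFun_mem_pair {D : Diagram} {f : ℤ × ℤ → ℕ} {k : ℕ} {j : ℤ} {p : ℤ × ℤ}
    (h : p ∈ freeBoxes D f k j) : bkFun D f k j p = k ∨ bkFun D f k j p = k + 1 := by
  rw [bkFun_of_mem h]
  have := (mem_freeBoxes.1 (rowReversal_mem h)).2.2.1
  omega

theorem bkFun_pair_iff {D : Diagram} {f : ℤ × ℤ → ℕ} {k : ℕ} {j : ℤ} (p : ℤ × ℤ) :
    (bkFun D f k j p = k ∨ bkFun D f k j p = k + 1) ↔ (f p = k ∨ f p = k + 1) := by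
  by_cases h : p ∈ freeBoxes D f k j
  · exact iff_of_true (bkFun_mem_pair h) (mem_freeBoxes.1 h).2.2.1
  · rw [bkFun_of_notMem h]

theorem freeBoxes_bkFun {D : Diagram} {f : ℤ × ℤ → ℕ} {k : ℕ} {j : ℤ} :
    freeBoxes D (bkFun D f k j) k j = freeBoxes D f k j :=
  freeBoxes_congr fun p _ _ => bkFun_pair_iff p

theorem bkFun_bkFun {D : Diagram} {f : ℤ × ℤ → ℕ} {k : ℕ} {j : ℤ} (p : ℤ × ℤ) :
    bkFun D (bkFun D f k j) k j p = f p := by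
  by_cases h : p ∈ freeBoxes D f k j
  · rw [bkFun_of_mem (by rwa [freeBoxes_bkFun]), freeBoxes_bkFun, bkFun_of_mem (rowReversal_mem h),
      rowReversal_rowReversal h]
    have := (mem_freeBoxes.1 h).2.2.1
    omega
  · rw [bkFun_of_notMem (by rwa [freeBoxes_bkFun]), bkFun_of_notMem h]

theorem bkFun_congr {D : Diagram} {f g : ℤ × ℤ → ℕ} {k : ℕ} {j : ℤ} (h : ∀ p ∈ D, f p = g p)
    {p : ℤ × ℤ} (hp : p ∈ D) : bkFun D f k j p = bkFun D g k j p := by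
  have hF : freeBoxes D f k j = freeBoxes D g k j := freeBoxes_congr fun p hp _ => by rw [h p hp]
  by_cases hpF : p ∈ freeBoxes D f k j
  · rw [bkFun_of_mem hpF, bkFun_of_mem (hF ▸ hpF), ← hF, h]
    exact (mem_freeBoxes.1 (rowReversal_mem hpF)).1
  · rw [bkFun_of_notMem hpF, bkFun_of_notMem (hF ▸ hpF), h p hp]

theorem mem_of_ordConnected {D : Diagram} (hD : (D : Set (ℤ × ℤ)).OrdConnected)
    {r x s y t z : ℤ} (h1 : (r, x) ∈ D) (h2 : (s, y) ∈ D) (hrt : r ≤ t) (hts : t ≤ s) (hxz : x ≤ z)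
    (hzy : z ≤ y) : (t, z) ∈ D :=
  Finset.mem_coe.1 (hD.out (Finset.mem_coe.2 h1) (Finset.mem_coe.2 h2)
    ⟨Prod.mk_le_mk.2 ⟨hrt, hxz⟩, Prod.mk_le_mk.2 ⟨hts, hzy⟩⟩)

/-- The condition under which the Bender-Knuth involution on the columns before `j` is compatible
with the entries in the columns from `j` on. -/
def BKAdmissible {D : Diagram} (T : SSYT D) (k : ℕ) (j : ℤ) : Prop :=
  ∀ r x y, (r, x) ∈ D → (r, y) ∈ D → x < j → j ≤ y → k ≤ T.val (r, x) → T.val (r, y) ≠ k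

/-- Order can only break between a free box and a non-free one. A non-free k has a k + 1 below it;
convexity then puts a k + 1 below any k to its left in the same row, so that k is not free either.
The mirror argument handles a non-free k + 1. Across the cut at column `j` the admissibility
condition takes over. -/
theorem bkFun_row {D : Diagram} (hD : (D : Set (ℤ × ℤ)).OrdConnected) (T : SSYT D) {k : ℕ} {j : ℤ}
    (H : BKAdmissible T k j)
    {r x y : ℤ} (hx : (r, x) ∈ D) (hy : (r, y) ∈ D) (hxy : x < y) :
    bkFun D T.val k j (r, x) ≤ bkFun D T.val k j (r, y) := by
  have hle := T.val_row hx hy hxy.le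
  by_cases hxF : (r, x) ∈ freeBoxes D T.val k j <;> by_cases hyF : (r, y) ∈ freeBoxes D T.val k j
  · rw [bkFun_of_mem hxF, bkFun_of_mem hyF]
    have h1 := (mem_freeBoxes.1 (rowReversal_mem hxF)).1
    have h2 := (mem_freeBoxes.1 (rowReversal_mem hyF)).1
    have h3 := rowReversal_snd hxF hyF hxy
    have h4 := rowReversal_fst (freeBoxes D T.val k j) (r, x)
    have h5 := rowReversal_fst (freeBoxes D T.val k j) (r, y)
    generalize rowReversal (freeBoxes D T.val k j) (r, x) = p at *
    generalize rowReversal (freeBoxes D T.val k j) (r, y) = q at *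
    obtain ⟨p1, p2⟩ := p
    obtain ⟨q1, q2⟩ := q
    simp only at h3 h4 h5
    subst h4 h5
    have := T.val_row h2 h1 h3.le
    omega
  · rw [bkFun_of_notMem hyF]
    have h1 := bkFun_mem_pair hxF
    obtain ⟨-, hxj, hxk, hxu⟩ := mem_freeBoxes.1 hxF
    suffices T.val (r, y) ≠ k by omega
    -- The only danger: the free box on the left becomes k + 1 while the box on the right keeps k.
    intro hyk
    by_cases hyj : y < j
    · apply hyF
      refine mem_freeBoxes.2 ⟨hy, hyj, Or.inl hyk, ?_⟩
      rintro ⟨s, z⟩ hs rfl hsk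
      by_contra hne
      have hsr : s ≠ r := fun h => hne (by rw [h])
      have hrs : r < s := by
        by_contra hlt
        have := T.val_col hs hy (by omega)
        simp only at *
        omega
      have hsx := mem_of_ordConnected hD hx hs hrs.le le_rfl le_rfl hxy.le
      have h2 := T.val_col hx hsx hrs
      have h3 := T.val_row hsx hs hxy.le
      have := hxu _ hsx rfl (by simp only at *; omega)
      simp only [Prod.mk.injEq] at this
      omega
    · exact H r x y hx hy hxj (by omega) (by omega) hyk
  · rw [bkFun_of_notMem hxF]
    have h1 := bkFun_mem_pair hyF
    obtain ⟨-, hyj, hyk, hyu⟩ := mem_freeBoxes.1 hyF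
    suffices T.val (r, x) ≠ k + 1 by omega
    intro hxk
    apply hxF
    refine mem_freeBoxes.2 ⟨hx, by simp only at *; omega, Or.inr hxk, ?_⟩
    rintro ⟨s, z⟩ hs rfl hsk
    by_contra hne
    have hsr : s ≠ r := fun h => hne (by rw [h])
    have hrs : s < r := by
      by_contra hlt
      have := T.val_col hx hs (by omega)
      simp only at *
      omega
    have hsy := mem_of_ordConnected hD hs hy le_rfl hrs.le hxy.le le_rfl
    have h2 := T.val_col hsy hy hrs
    have h3 := T.val_row hs hsy hxy.le
    have := hyu _ hsy rfl (by simp only at *; omega)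
    simp only [Prod.mk.injEq] at this
    omega
  · rwa [bkFun_of_notMem hxF, bkFun_of_notMem hyF]

theorem bkFun_col {D : Diagram} (T : SSYT D) {k : ℕ} {j : ℤ}
    {r s x : ℤ} (hr : (r, x) ∈ D) (hs : (s, x) ∈ D) (hrs : r < s) :
    bkFun D T.val k j (r, x) < bkFun D T.val k j (s, x) := by
  have hlt := T.val_col hr hs hrs
  by_cases hrF : (r, x) ∈ freeBoxes D T.val k j <;> by_cases hsF : (s, x) ∈ freeBoxes D T.val k j
  · have := (mem_freeBoxes.1 hrF).2.2.2 _ hs rfl (mem_freeBoxes.1 hsF).2.2.1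
    simp only [Prod.mk.injEq] at this
    omega
  · rw [bkFun_of_notMem hsF]
    have h1 := bkFun_mem_pair hrF
    obtain ⟨-, hj, hk, hu⟩ := mem_freeBoxes.1 hrF
    have h2 : ¬ (T.val (s, x) = k ∨ T.val (s, x) = k + 1) := fun h => by
      have := hu _ hs rfl h
      simp only [Prod.mk.injEq] at this
      omega
    omega
  · rw [bkFun_of_notMem hrF]
    have h1 := bkFun_mem_pair hsF
    obtain ⟨-, hj, hk, hu⟩ := mem_freeBoxes.1 hsF
    have h2 : ¬ (T.val (r, x) = k ∨ T.val (r, x) = k + 1) := fun h => by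
      have := hu _ hr rfl h
      simp only [Prod.mk.injEq] at this
      omega
    omega
  · rwa [bkFun_of_notMem hrF, bkFun_of_notMem hsF]

/-- The Bender-Knuth involution on the entries `k` and `k + 1` in the columns before `j`. -/
def SSYT.bk {D : Diagram} (hD : (D : Set (ℤ × ℤ)).OrdConnected) (T : SSYT D) (k : ℕ) (j : ℤ)
    (H : BKAdmissible T k j) : SSYT D :=
  SSYT.ofFun (bkFun D T.val k j) (fun _ _ _ hx hy h => bkFun_row hD T H hx hy h)
    (fun _ _ _ hr hs h => bkFun_col T hr hs h)

theorem SSYT.val_bk {D : Diagram} {hD : (D : Set (ℤ × ℤ)).OrdConnected} {T : SSYT D} {k : ℕ}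
    {j : ℤ} {H} {p : ℤ × ℤ} (hp : p ∈ D) : (T.bk hD k j H).val p = bkFun D T.val k j p :=
  SSYT.val_ofFun hp

theorem SSYT.val_bk_of_le {D : Diagram} {hD : (D : Set (ℤ × ℤ)).OrdConnected} {T : SSYT D} {k : ℕ}
    {j : ℤ} {H} {p : ℤ × ℤ} (hp : p ∈ D) (h : j ≤ p.2) : (T.bk hD k j H).val p = T.val p := by
  rw [SSYT.val_bk hp, bkFun_of_le h]

theorem BKAdmissible.bk {D : Diagram} {hD : (D : Set (ℤ × ℤ)).OrdConnected} {T : SSYT D} {k : ℕ}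
    {j : ℤ} (H : BKAdmissible T k j) : BKAdmissible (T.bk hD k j H) k j := by
  intro r x y hx hy hxj hyj hk
  rw [SSYT.val_bk_of_le hy hyj]
  refine H r x y hx hy hxj hyj ?_
  rw [SSYT.val_bk hx] at hk
  by_cases hF : (r, x) ∈ freeBoxes D T.val k j
  · have := (mem_freeBoxes.1 hF).2.2.1
    omega
  · rwa [bkFun_of_notMem hF] at hk

theorem SSYT.bk_bk {D : Diagram} {hD : (D : Set (ℤ × ℤ)).OrdConnected} {T : SSYT D} {k : ℕ}
    {j : ℤ} {H H'} : (T.bk hD k j H).bk hD k j H' = T := by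
  apply SSYT.ext_val
  intro p hp
  rw [SSYT.val_bk hp, bkFun_congr (fun q hq => SSYT.val_bk hq) hp, bkFun_bkFun]

theorem SSYT.cntLT_bk_of_ne {D : Diagram} {hD : (D : Set (ℤ × ℤ)).OrdConnected} {T : SSYT D} {k : ℕ}
    {j : ℤ} {H} {i : ℕ} (h1 : i ≠ k) (h2 : i ≠ k + 1) :
    (T.bk hD k j H).cntLT j i = T.cntLT j i := by
  rw [SSYT.cntLT, SSYT.cntLT]
  congr 1
  refine Finset.filter_congr fun p hp => ?_
  rw [SSYT.val_bk hp]
  have h := bkFun_pair_iff (D := D) (f := T.val) (k := k) (j := j) p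
  by_cases hF : p ∈ freeBoxes D T.val k j
  · have h3 := (mem_freeBoxes.1 hF).2.2.1
    omega
  · rw [bkFun_of_notMem hF]

/-- In the boxes that are not free, the entries `k` and `k + 1` are equinumerous: each column that
contains one of them contains the other. -/
theorem card_filter_not_free {D : Diagram} (T : SSYT D) (k : ℕ) (j : ℤ) :
    (D.filter (fun p => p.2 < j ∧ T.val p = k ∧ p ∉ freeBoxes D T.val k j)).card =
      (D.filter (fun p => p.2 < j ∧ T.val p = k + 1 ∧ p ∉ freeBoxes D T.val k j)).card := by
  have partner : ∀ (a b : ℕ) (_ : a = k ∧ b = k + 1 ∨ a = k + 1 ∧ b = k) (p : ℤ × ℤ), p ∈ D →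
      p.2 < j → T.val p = a → p ∉ freeBoxes D T.val k j →
      ∃ r, (r, p.2) ∈ D ∧ T.val (r, p.2) = b ∧ (r, p.2) ∉ freeBoxes D T.val k j := by
    intro a b hab p hp hpj hpa hpF
    rw [mem_freeBoxes] at hpF
    push Not at hpF
    obtain ⟨⟨r, y⟩, hq, hqp, hqk, hne⟩ := hpF hp hpj (by omega)
    simp only at hqp
    subst hqp
    refine ⟨r, hq, ?_, ?_⟩
    · by_contra hb
      apply hne
      have : r = p.1 := T.row_eq_of_val_eq hq hp (by rw [hpa]; omega)
      rw [this]
    · rw [mem_freeBoxes]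
      rintro ⟨-, -, -, h⟩
      exact hne (h p hp rfl (by omega)).symm
  have key : ∀ (a b : ℕ) (_ : a = k ∧ b = k + 1 ∨ a = k + 1 ∧ b = k),
      (D.filter (fun p => p.2 < j ∧ T.val p = a ∧ p ∉ freeBoxes D T.val k j)).card ≤
      (D.filter (fun p => p.2 < j ∧ T.val p = b ∧ p ∉ freeBoxes D T.val k j)).card := by
    intro a b hab
    have hsub : (D.filter (fun p => p.2 < j ∧ T.val p = a ∧ p ∉ freeBoxes D T.val k j)).image
        Prod.snd ⊆ (D.filter (fun p => p.2 < j ∧ T.val p = b ∧ p ∉ freeBoxes D T.val k j)).image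
        Prod.snd := by
      intro y hy
      simp only [Finset.mem_image, Finset.mem_filter] at hy ⊢
      obtain ⟨p, ⟨hp, hpj, hpa, hpF⟩, rfl⟩ := hy
      obtain ⟨r, h1, h2, h3⟩ := partner a b hab p hp hpj hpa hpF
      exact ⟨_, ⟨h1, hpj, h2, h3⟩, rfl⟩
    have hc := (Finset.card_le_card hsub).trans Finset.card_image_le
    rwa [Finset.card_image_of_injOn] at hc
    rintro ⟨r, x⟩ hp ⟨s, y⟩ hq hxy
    simp only [Finset.coe_filter, Set.mem_ofPred_eq] at hp hq hxy
    subst hxy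
    rw [T.row_eq_of_val_eq hp.1 hq.1 (by rw [hp.2.2.1, hq.2.2.1])]
  exact le_antisymm (key _ _ (by omega)) (key _ _ (by omega))

/-- The non-free boxes contain as many k as k + 1, and on the free boxes row reversal matches the
new entries k with the old entries k + 1. -/
theorem SSYT.cntLT_bk_left {D : Diagram} {hD : (D : Set (ℤ × ℤ)).OrdConnected} {T : SSYT D} {k : ℕ}
    {j : ℤ} {H} : (T.bk hD k j H).cntLT j k = T.cntLT j (k + 1) := by
  have split : ∀ (f : ℤ × ℤ → ℕ) (i : ℕ), (D.filter (fun p => p.2 < j ∧ f p = i)).card =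
      ((freeBoxes D T.val k j).filter (fun p => f p = i)).card +
      (D.filter (fun p => p.2 < j ∧ f p = i ∧ p ∉ freeBoxes D T.val k j)).card := by
    intro f i
    rw [← Finset.card_union_of_disjoint]
    · congr 1
      ext p
      simp only [Finset.mem_union, Finset.mem_filter]
      have := @mem_freeBoxes D T.val k j p
      tauto
    · rw [Finset.disjoint_left]
      intro p hp hq
      exact (Finset.mem_filter.1 hq).2.2.2 (Finset.mem_filter.1 hp).1
  have h0 : (T.bk hD k j H).cntLT j k =
      (D.filter (fun p => p.2 < j ∧ bkFun D T.val k j p = k)).card := by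
    rw [SSYT.cntLT]
    congr 1
    exact Finset.filter_congr fun p hp => by rw [SSYT.val_bk hp]
  rw [h0, SSYT.cntLT, split _ k, split _ (k + 1), ← card_filter_not_free]
  congr 1
  · refine Finset.card_nbij' (rowReversal (freeBoxes D T.val k j))
      (rowReversal (freeBoxes D T.val k j)) ?_ ?_ ?_ ?_
    · intro p hp
      simp only [Finset.coe_filter, Set.mem_ofPred_eq] at hp ⊢
      refine ⟨rowReversal_mem hp.1, ?_⟩
      have h2 := hp.2
      have h3 := (mem_freeBoxes.1 (rowReversal_mem hp.1)).2.2.1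
      rw [bkFun_of_mem hp.1] at h2
      omega
    · intro p hp
      simp only [Finset.coe_filter, Set.mem_ofPred_eq] at hp ⊢
      refine ⟨rowReversal_mem hp.1, ?_⟩
      rw [bkFun_of_mem (rowReversal_mem hp.1), rowReversal_rowReversal hp.1, hp.2]
      omega
    · intro p hp
      exact rowReversal_rowReversal (Finset.mem_filter.1 hp).1
    · intro p hp
      exact rowReversal_rowReversal (Finset.mem_filter.1 hp).1
  · congr 1
    refine Finset.filter_congr fun p _ => ?_
    constructor
    · rintro ⟨h1, h2, h3⟩
      exact ⟨h1, by rwa [bkFun_of_notMem h3] at h2, h3⟩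
    · rintro ⟨h1, h2, h3⟩
      exact ⟨h1, by rwa [bkFun_of_notMem h3], h3⟩

theorem SSYT.cntLT_bk_right {D : Diagram} {hD : (D : Set (ℤ × ℤ)).OrdConnected} {T : SSYT D}
    {k : ℕ} {j : ℤ} {H} : (T.bk hD k j H).cntLT j (k + 1) = T.cntLT j k := by
  rw [← SSYT.cntLT_bk_left (hD := hD) (H := H.bk), SSYT.bk_bk]

theorem SSYT.cnt_bk {D : Diagram} {hD : (D : Set (ℤ × ℤ)).OrdConnected} {T : SSYT D}
    {k : ℕ} {j : ℤ} {H} {c : ℤ} (hc : j ≤ c) (i : ℕ) : (T.bk hD k j H).cnt c i = T.cnt c i := by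
  rw [SSYT.cnt, SSYT.cnt]
  congr 1
  refine Finset.filter_congr fun p hp => and_congr_right fun h => ?_
  rw [SSYT.val_bk_of_le hp (hc.trans h)]

theorem SSYT.val_bk_lt {D : Diagram} {hD : (D : Set (ℤ × ℤ)).OrdConnected} {T : SSYT D}
    {k : ℕ} {j : ℤ} {H} {n : ℕ} (hk : k + 1 < n) (h : ∀ p ∈ D, T.val p < n) :
    ∀ p ∈ D, (T.bk hD k j H).val p < n := by
  intro p hp
  rw [SSYT.val_bk hp]
  by_cases hF : p ∈ freeBoxes D T.val k j
  · have := bkFun_mem_pair hF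
    omega
  · rw [bkFun_of_notMem hF]
    exact h p hp

/-! ### Tableaux with bounded entries and the symmetry of skew Schur functions -/

/-- The tableaux of shape `D` with entries smaller than `n`. -/
abbrev BddSSYT (D : Diagram) (n : ℕ) := {T : SSYT D // ∀ p ∈ D, T.val p < n}

instance (D : Diagram) (n : ℕ) : Finite (BddSSYT D n) := by
  refine Finite.of_injective
    (fun (T : BddSSYT D n) (p : D) => (⟨T.1.val p.1, T.2 _ p.2⟩ : Fin n)) ?_
  intro T T' h
  apply Subtype.ext
  apply SSYT.ext_val
  intro p hp
  simpa using congrFun h ⟨p, hp⟩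

instance (D : Diagram) (n : ℕ) : Fintype (BddSSYT D n) := Fintype.ofFinite _

theorem SSYT.wt_bk {D : Diagram} {hD : (D : Set (ℤ × ℤ)).OrdConnected} {T : SSYT D}
    {k : ℕ} {j : ℤ} {H : BKAdmissible T k j} (hj : ∀ p ∈ D, p.2 < j) (i : ℕ) :
    (T.bk hD k j H).wt i = T.wt (Equiv.swap k (k + 1) i) := by
  rw [← SSYT.cntLT_eq_wt _ hj, ← SSYT.cntLT_eq_wt _ hj]
  by_cases h1 : i = k
  · subst h1; rw [SSYT.cntLT_bk_left, Equiv.swap_apply_left]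
  by_cases h2 : i = k + 1
  · subst h2; rw [SSYT.cntLT_bk_right, Equiv.swap_apply_right]
  · rw [SSYT.cntLT_bk_of_ne h1 h2, Equiv.swap_apply_of_ne_of_ne h1 h2]

theorem sum_wt_swap {M : Type*} [AddCommMonoid M] {D : Diagram}
    (hD : (D : Set (ℤ × ℤ)).OrdConnected) {n k : ℕ} (hk : k + 1 < n) (f : (ℕ → ℕ) → M) :
    ∑ T : BddSSYT D n, f (fun i => T.1.wt (Equiv.swap k (k + 1) i)) =
      ∑ T : BddSSYT D n, f T.1.wt := by
  obtain ⟨j, hj⟩ := exists_upper_col D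
  have adm : ∀ T : SSYT D, BKAdmissible T k j := fun T r x y _ hy _ h => by
    have := hj _ hy
    simp only at this
    omega
  let e : BddSSYT D n ≃ BddSSYT D n :=
    { toFun := fun T => ⟨T.1.bk hD k j (adm _), SSYT.val_bk_lt hk T.2⟩
      invFun := fun T => ⟨T.1.bk hD k j (adm _), SSYT.val_bk_lt hk T.2⟩
      left_inv := fun T => Subtype.ext (SSYT.bk_bk (hD := hD) (H := adm _) (H' := adm _))
      right_inv := fun T => Subtype.ext (SSYT.bk_bk (hD := hD) (H := adm _) (H' := adm _)) }
  rw [← e.sum_comp]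
  refine Finset.sum_congr rfl fun T _ => ?_
  congr 1
  funext i
  exact (SSYT.wt_bk (hD := hD) (H := adm T.1) hj _).trans (by rw [Equiv.swap_apply_self])

/-- The multiset of contents of the tableaux of a given shape is symmetric. -/
theorem sum_wt_perm {M : Type*} [AddCommMonoid M] {D : Diagram}
    (hD : (D : Set (ℤ × ℤ)).OrdConnected) {n : ℕ} (σ : Equiv.Perm (Fin n)) (f : (Fin n → ℕ) → M) :
    ∑ T : BddSSYT D n, f (fun i => T.1.wt (σ i)) = ∑ T : BddSSYT D n, f (fun i => T.1.wt i) := by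
  cases n with
  | zero => exact Finset.sum_congr rfl fun T _ => congrArg f (Subsingleton.elim _ _)
  | succ n =>
    -- Adjacent transpositions generate the symmetric group, and each is handled by one Bender–Knuth
    -- involution whose cut lies beyond all columns.
    have hσ : σ ∈ Submonoid.closure
        (Set.range fun i : Fin n => Equiv.swap i.castSucc i.succ) := by
      rw [Equiv.Perm.mclosure_swap_castSucc_succ]
      trivial
    induction hσ using Submonoid.closure_induction generalizing f with
    | mem σ hσ =>
      obtain ⟨i, rfl⟩ := hσ
      rw [← sum_wt_swap hD (k := i) (by omega) (fun u => f (fun i : Fin (n + 1) => u i))]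
      refine Finset.sum_congr rfl fun T _ => congrArg f (funext fun l => congrArg _ ?_)
      have := (Fin.val_injective (n := n + 1)).swap_apply i.castSucc i.succ l
      simpa using this.symm
    | one => rfl
    | mul σ τ _ _ h1 h2 => exact (h1 (fun u => f (fun i => u (τ i)))).trans (h2 f)

/-! ### Alternants -/

open MvPolynomial in
/-- The alternant `det (x_i ^ β_j)`. -/
def alternant {n : ℕ} (β : Fin n → ℕ) : MvPolynomial (Fin n) ℤ :=
  (Matrix.of fun i j : Fin n => (X i : MvPolynomial (Fin n) ℤ) ^ β j).det

theorem alternant_comp_perm {n : ℕ} (β : Fin n → ℕ) (σ : Equiv.Perm (Fin n)) :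
    alternant (fun i => β (σ i)) = ((Equiv.Perm.sign σ : ℤ) : MvPolynomial (Fin n) ℤ) * alternant β :=
  Matrix.det_permute' σ (Matrix.of fun i j : Fin n => (MvPolynomial.X i : MvPolynomial (Fin n) ℤ) ^ β j)

theorem alternant_swap {n : ℕ} (β : Fin n → ℕ) {a b : Fin n} (h : a ≠ b) :
    alternant (fun i => β (Equiv.swap a b i)) = -alternant β := by
  rw [alternant_comp_perm, Equiv.Perm.sign_swap h]
  simp

/-- The exponents `(n - 1, …, 1, 0)`. -/
def staircase {n : ℕ} (i : Fin n) : ℕ := n - 1 - i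

theorem alternant_staircase_ne_zero (n : ℕ) : alternant (staircase (n := n)) ≠ 0 := by
  have h : alternant (fun i : Fin n => staircase (Fin.revPerm i)) ≠ 0 := by
    have : (fun i : Fin n => staircase (Fin.revPerm i)) = fun i : Fin n => (i : ℕ) := by
      funext i
      simp only [staircase, Fin.revPerm_apply, Fin.val_rev]
      omega
    rw [this]
    exact Matrix.det_vandermonde_ne_zero_iff.2 (MvPolynomial.X_injective)
  rw [alternant_comp_perm] at h
  exact right_ne_zero_of_mul h

/-- The skew Schur polynomial in `n` variables. -/
def schurPoly (n : ℕ) (D : Diagram) : MvPolynomial (Fin n) ℤ :=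
  ∑ T : BddSSYT D n, ∏ i : Fin n, MvPolynomial.X i ^ T.1.wt i

/-- Expand the determinant. In the term of σ, symmetry of the contents allows them to be permuted by
σ, after which they add to the exponents of the staircase. -/
theorem alternant_mul_schurPoly {D : Diagram} (hD : (D : Set (ℤ × ℤ)).OrdConnected) (n : ℕ) :
    alternant (staircase (n := n)) * schurPoly n D =
      ∑ T : BddSSYT D n, alternant (fun i => staircase i + T.1.wt i) := by
  simp only [alternant, Matrix.det_apply]
  rw [Finset.sum_comm, Finset.sum_mul]
  refine Finset.sum_congr rfl fun σ _ => ?_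
  rw [← Finset.smul_sum, smul_mul_assoc]
  congr 1
  simp only [Matrix.of_apply, pow_add, Finset.prod_mul_distrib]
  rw [← Finset.mul_sum]
  congr 1
  rw [schurPoly, ← sum_wt_perm hD σ⁻¹
    (fun u => ∏ i, (MvPolynomial.X i : MvPolynomial (Fin n) ℤ) ^ u i)]
  refine Finset.sum_congr rfl fun T _ => ?_
  rw [← Equiv.prod_comp σ]
  simp

/-! ### Cancellation of the tableaux that are not lattice tableaux -/

/-- Column `c` is the last column at which the lattice condition fails, and `k` is the smallest
entry for which it fails there. -/
def IsFirstViolation {D : Diagram} (T : SSYT D) (c : ℤ) (k : ℕ) : Prop :=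
  T.cnt c k < T.cnt c (k + 1) ∧ (∀ c', c < c' → ∀ i, T.cnt c' (i + 1) ≤ T.cnt c' i) ∧
    ∀ i < k, T.cnt c (i + 1) ≤ T.cnt c i

theorem exists_isFirstViolation {D : Diagram} {T : SSYT D} (h : ¬ T.IsLR) :
    ∃ p : ℤ × ℕ, IsFirstViolation T p.1 p.2 := by
  classical
  rw [SSYT.IsLR] at h
  push Not at h
  obtain ⟨u, hu⟩ := exists_upper_col D
  obtain ⟨c, hc, hmax⟩ := Int.exists_greatest_of_bdd (P := fun c => ∃ k, T.cnt c k < T.cnt c (k + 1))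
    ⟨u, fun z ⟨k, hk⟩ => by
      by_contra hz
      rw [T.cnt_eq_zero (fun p hp => (hu p hp).trans (by omega))] at hk
      rw [T.cnt_eq_zero (fun p hp => (hu p hp).trans (by omega))] at hk
      omega⟩ h
  refine ⟨(c, Nat.find hc), Nat.find_spec hc, ?_, ?_⟩
  · intro c' hc' i
    by_contra hi
    have := hmax c' ⟨i, by omega⟩
    simp only at hc'
    omega
  · intro i hi
    have := Nat.find_min hc hi
    simpa using this

theorem IsFirstViolation.unique {D : Diagram} {T : SSYT D} {c c' : ℤ} {k k' : ℕ}
    (h : IsFirstViolation T c k) (h' : IsFirstViolation T c' k') : c = c' ∧ k = k' := by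
  have hc : c = c' := by
    rcases lt_trichotomy c c' with hlt | heq | hgt
    · have := h.2.1 c' hlt k'; have := h'.1; omega
    · exact heq
    · have := h'.2.1 c hgt k; have := h.1; omega
  subst hc
  refine ⟨rfl, ?_⟩
  rcases lt_trichotomy k k' with hlt | heq | hgt
  · have := h'.2.2 k hlt; have := h.1; omega
  · exact heq
  · have := h.2.2 k' hgt; have := h'.1; omega

theorem SSYT.cnt_eq_cnt_add_one {D : Diagram} (T : SSYT D) (c : ℤ) (k : ℕ) :
    T.cnt c k = T.cnt (c + 1) k + (D.filter (fun p => p.2 = c ∧ T.val p = k)).card := by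
  rw [SSYT.cnt, SSYT.cnt, ← Finset.card_union_of_disjoint]
  · congr 1
    ext p
    simp only [Finset.mem_filter, Finset.mem_union]
    have : c ≤ p.2 ↔ c + 1 ≤ p.2 ∨ p.2 = c := by omega
    tauto
  · rw [Finset.disjoint_left]
    intro p hp hq
    simp only [Finset.mem_filter] at hp hq
    omega

theorem SSYT.card_col_le_one {D : Diagram} (T : SSYT D) (c : ℤ) (k : ℕ) :
    (D.filter (fun p => p.2 = c ∧ T.val p = k)).card ≤ 1 := by
  rw [Finset.card_le_one]
  rintro ⟨r, x⟩ hp ⟨s, y⟩ hq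
  simp only [Finset.mem_filter] at hp hq
  obtain ⟨hp, rfl, hpk⟩ := hp
  obtain ⟨hq, rfl, hqk⟩ := hq
  rw [T.row_eq_of_val_eq hp hq (by rw [hpk, hqk])]

/-- A column holds at most one k + 1, and just to the right of it the condition still held, so the
excess is exactly one. This is what the shift by the staircase compensates in
`IsFirstViolation.alternant_bk`. -/
theorem IsFirstViolation.cnt_succ {D : Diagram} {T : SSYT D} {c : ℤ} {k : ℕ}
    (h : IsFirstViolation T c k) : T.cnt c (k + 1) = T.cnt c k + 1 := by
  have h1 := h.1
  have h2 := h.2.1 (c + 1) (by omega) k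
  have h3 := T.cnt_eq_cnt_add_one c k
  have h4 := T.cnt_eq_cnt_add_one c (k + 1)
  have h5 := T.card_col_le_one c (k + 1)
  omega

theorem IsFirstViolation.val_ne {D : Diagram} {T : SSYT D} {c : ℤ} {k : ℕ}
    (h : IsFirstViolation T c k) {r : ℤ} (hr : (r, c) ∈ D) : T.val (r, c) ≠ k := by
  intro hk
  have h1 := h.1
  have h2 := h.2.1 (c + 1) (by omega) k
  have h3 := T.cnt_eq_cnt_add_one c k
  have h4 := T.cnt_eq_cnt_add_one c (k + 1)
  have h5 := T.card_col_le_one c (k + 1)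
  have h6 : 0 < (D.filter (fun p => p.2 = c ∧ T.val p = k)).card :=
    Finset.card_pos.2 ⟨(r, c), by simp [hr, hk]⟩
  omega

/-- Column `c` contains no k, for otherwise the violation would already occur to its right. By
convexity, a row with an entry at least k before the cut and a k from the cut on would have a k in
column `c` itself. -/
theorem IsFirstViolation.admissible {D : Diagram} (hD : (D : Set (ℤ × ℤ)).OrdConnected)
    {T : SSYT D} {c : ℤ} {k : ℕ} (h : IsFirstViolation T c k) : BKAdmissible T k c := by
  intro r x y hx hy hxc hcy hk
  have hc := mem_of_ordConnected hD hx hy le_rfl le_rfl hxc.le hcy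
  have h1 := h.val_ne hc
  have h2 := T.val_row hx hc hxc.le
  have h3 := T.val_row hc hy hcy
  omega

theorem IsFirstViolation.bk {D : Diagram} {hD : (D : Set (ℤ × ℤ)).OrdConnected}
    {T : SSYT D} {c : ℤ} {k : ℕ} (h : IsFirstViolation T c k) {H} :
    IsFirstViolation (T.bk hD k c H) c k := by
  refine ⟨?_, ?_, ?_⟩
  · rw [SSYT.cnt_bk le_rfl, SSYT.cnt_bk le_rfl]; exact h.1
  · intro c' hc' i
    rw [SSYT.cnt_bk hc'.le, SSYT.cnt_bk hc'.le]; exact h.2.1 c' hc' i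
  · intro i hi
    rw [SSYT.cnt_bk le_rfl, SSYT.cnt_bk le_rfl]; exact h.2.2 i hi

theorem IsFirstViolation.succ_lt {D : Diagram} {T : SSYT D} {c : ℤ} {k n : ℕ}
    (h : IsFirstViolation T c k) (hT : ∀ p ∈ D, T.val p < n) : k + 1 < n := by
  have h1 : 0 < T.cnt c (k + 1) := (Nat.zero_le _).trans_lt h.1
  obtain ⟨p, hp⟩ := Finset.card_pos.1 h1
  simp only [Finset.mem_filter] at hp
  have := hT p hp.1
  omega

/-- The counts of k and k + 1 are exchanged only before column `c`; from there on, k + 1 leads by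
one. As the staircase exponents at k and k + 1 also differ by one, the total exponents are exactly
exchanged and the determinant changes sign. -/
theorem IsFirstViolation.alternant_bk {D : Diagram} {hD : (D : Set (ℤ × ℤ)).OrdConnected}
    {T : SSYT D} {c : ℤ} {k n : ℕ} (h : IsFirstViolation T c k) {H} (hk : k + 1 < n) :
    alternant (fun i : Fin n => staircase i + (T.bk hD k c H).wt i) =
      -alternant (fun i : Fin n => staircase i + T.wt i) := by
  have hne : (⟨k, by omega⟩ : Fin n) ≠ ⟨k + 1, hk⟩ := by simp
  rw [← alternant_swap _ hne]
  congr 1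
  funext i
  have hc := h.cnt_succ
  have h1 := T.wt_eq_cntLT_add_cnt c
  have h2 := (T.bk hD k c H).wt_eq_cntLT_add_cnt c
  by_cases hi : i = ⟨k, by omega⟩
  · subst hi
    rw [Equiv.swap_apply_left]
    simp only [staircase]
    rw [h2, SSYT.cntLT_bk_left, SSYT.cnt_bk le_rfl, h1]
    omega
  by_cases hi' : i = ⟨k + 1, hk⟩
  · subst hi'
    rw [Equiv.swap_apply_right]
    simp only [staircase]
    rw [h2, SSYT.cntLT_bk_right, SSYT.cnt_bk le_rfl, h1]
    omega
  · rw [Equiv.swap_apply_of_ne_of_ne hi hi', h2, SSYT.cnt_bk le_rfl, SSYT.cntLT_bk_of_ne, ← h1]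
    · intro h; exact hi (Fin.ext h)
    · intro h; exact hi' (Fin.ext h)

-- Sign-reversing involution: apply Bender–Knuth for the entries k, k + 1 strictly before the first
-- violation (c, k). The columns from `c` on determine that violation and are left alone.
open Classical in
theorem sum_alternant_not_isLR {D : Diagram} (hD : (D : Set (ℤ × ℤ)).OrdConnected) (n : ℕ) :
    ∑ T : BddSSYT D n with ¬ T.1.IsLR, alternant (fun i : Fin n => staircase i + T.1.wt i) = 0 := by
  have hex : ∀ T : SSYT D, ∃ p : ℤ × ℕ, ¬ T.IsLR → IsFirstViolation T p.1 p.2 := fun T => by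
    by_cases h : T.IsLR
    · exact ⟨(0, 0), fun h' => absurd h h'⟩
    · exact (exists_isFirstViolation h).imp fun _ hp _ => hp
  choose v hv using hex
  have hm : ∀ T ∈ Finset.univ.filter (fun T : BddSSYT D n => ¬ T.1.IsLR), ¬ T.1.IsLR :=
    fun T hT => (Finset.mem_filter.1 hT).2
  have hnot : ∀ (T : SSYT D) (h : ¬ T.IsLR),
      ¬ (T.bk hD (v T).2 (v T).1 ((hv T h).admissible hD)).IsLR := by
    intro T h hLR
    have h1 := (hv T h).bk (hD := hD) (H := (hv T h).admissible hD)
    have h2 := hLR (v T).1 (v T).2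
    have h3 := h1.1
    omega
  refine Finset.sum_involution (fun T hT => ⟨T.1.bk hD (v T.1).2 (v T.1).1
    ((hv T.1 (hm T hT)).admissible hD), SSYT.val_bk_lt ((hv T.1 (hm T hT)).succ_lt T.2) T.2⟩)
    ?_ ?_ ?_ ?_
  · intro T hT
    rw [(hv T.1 (hm T hT)).alternant_bk ((hv T.1 (hm T hT)).succ_lt T.2), add_neg_cancel]
  -- A fixed tableau has an alternant equal to its own negative, hence zero.
  · intro T hT hne heq
    apply hne
    have h := (hv T.1 (hm T hT)).alternant_bk (hD := hD) (H := (hv T.1 (hm T hT)).admissible hD)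
      ((hv T.1 (hm T hT)).succ_lt T.2)
    have heq' := congrArg Subtype.val heq
    simp only at heq'
    rw [heq'] at h
    exact self_eq_neg.1 h
  · intro T hT
    exact Finset.mem_filter.2 ⟨Finset.mem_univ _, hnot T.1 (hm T hT)⟩
  · intro T hT
    apply Subtype.ext
    have h := (hv _ (hnot T.1 (hm T hT))).unique ((hv T.1 (hm T hT)).bk (hD := hD)
      (H := (hv T.1 (hm T hT)).admissible hD))
    apply SSYT.ext_val
    intro q hq
    rw [SSYT.val_bk hq, bkFun_congr (fun q hq => SSYT.val_bk hq) hq, h.1, h.2, bkFun_bkFun]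

open Classical in
/-- The Littlewood-Richardson rule, in terms of alternants. -/
theorem alternant_mul_schurPoly_eq_sum_isLR {D : Diagram} (hD : (D : Set (ℤ × ℤ)).OrdConnected)
    (n : ℕ) : alternant (staircase (n := n)) * schurPoly n D =
      ∑ T : BddSSYT D n with T.1.IsLR, alternant (fun i : Fin n => staircase i + T.1.wt i) := by
  rw [alternant_mul_schurPoly hD, ← Finset.sum_filter_add_sum_filter_not Finset.univ
    (fun T : BddSSYT D n => T.1.IsLR), sum_alternant_not_isLR hD, add_zero]

/-! ### Partitions and their row lengths -/

theorem youngDiagram_ext_rowLen {μ ν : YoungDiagram} (h : ∀ i, μ.rowLen i = ν.rowLen i) : μ = ν := by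
  apply YoungDiagram.ext
  ext ⟨i, j⟩
  rw [YoungDiagram.mem_cells, YoungDiagram.mem_cells, YoungDiagram.mem_iff_lt_rowLen,
    YoungDiagram.mem_iff_lt_rowLen, h]

theorem exists_rowLen_eq (f : ℕ → ℕ) (hf : Antitone f) {n : ℕ} (hn : f n = 0) :
    ∃ ν : YoungDiagram, ∀ i, ν.rowLen i = f i := by
  have hlt : ∀ {i j}, j < f i → i < n := fun {i j} h => by
    by_contra hi
    have := hf (not_lt.1 hi)
    omega
  let ν : YoungDiagram :=
    { cells := (Finset.range n ×ˢ Finset.range (f 0)).filter (fun p => p.2 < f p.1)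
      isLowerSet := by
        rintro ⟨a, b⟩ ⟨c, d⟩ hle hab
        have h1 : c ≤ a := hle.1
        have h2 : d ≤ b := hle.2
        simp only [Finset.coe_filter, Finset.mem_product, Finset.mem_range, Set.mem_ofPred_eq] at hab ⊢
        have := hf h1
        omega }
  have hmem : ∀ i j, (i, j) ∈ ν ↔ j < f i := by
    intro i j
    rw [← YoungDiagram.mem_cells]
    simp only [ν, Finset.mem_filter, Finset.mem_product, Finset.mem_range]
    refine ⟨fun h => h.2, fun h => ⟨⟨hlt h, ?_⟩, h⟩⟩
    exact h.trans_le (hf (Nat.zero_le i))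
  refine ⟨ν, fun i => ?_⟩
  have h1 := hmem i (f i)
  have h2 := hmem i (ν.rowLen i)
  rw [YoungDiagram.mem_iff_lt_rowLen] at h1 h2
  omega

theorem card_eq_sum_rowLen (ν : YoungDiagram) {n : ℕ} (hn : ν.rowLen n = 0) :
    ν.card = ∑ i ∈ Finset.range n, ν.rowLen i := by
  have : ∀ p ∈ ν.cells, p.1 ∈ Finset.range n := by
    rintro ⟨i, j⟩ h
    rw [YoungDiagram.mem_cells, YoungDiagram.mem_iff_lt_rowLen] at h
    rw [Finset.mem_range]
    by_contra hi
    have := ν.rowLen_anti n i (not_lt.1 hi)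
    omega
  rw [YoungDiagram.card, Finset.card_eq_sum_card_fiberwise this]
  refine Finset.sum_congr rfl fun i _ => ?_
  rw [YoungDiagram.rowLen_eq_card]
  rfl

theorem rowLen_card (ν : YoungDiagram) : ν.rowLen ν.card = 0 := by
  by_contra h
  have hsub : (Finset.range (ν.card + 1)).image (fun i => (i, 0)) ⊆ ν.cells := by
    intro p hp
    simp only [Finset.mem_image, Finset.mem_range] at hp
    obtain ⟨i, hi, rfl⟩ := hp
    rw [YoungDiagram.mem_cells, YoungDiagram.mem_iff_lt_rowLen]
    have := ν.rowLen_anti i ν.card (by omega)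
    omega
  have := Finset.card_le_card hsub
  rw [Finset.card_image_of_injective _ (fun a b h => by simpa using h), Finset.card_range] at this
  exact absurd this (Nat.not_succ_le_self _)

/-- The partitions of `n`. -/
def partitionsOf (n : ℕ) : Finset YoungDiagram := (finite_card_eq n).toFinset

theorem mem_partitionsOf {n : ℕ} {ν : YoungDiagram} : ν ∈ partitionsOf n ↔ ν.card = n := by
  simp [partitionsOf]

/-- The content of a lattice tableau is a partition. -/
theorem SSYT.IsLR.exists_shape {D : Diagram} {T : SSYT D} (h : T.IsLR) :
    ∃ ν ∈ partitionsOf D.card, ∀ k, T.wt k = ν.rowLen k := by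
  have h0 : T.wt D.card = 0 := T.wt_eq_zero (fun p hp => h.val_lt_card hp) le_rfl
  obtain ⟨ν, hν⟩ := exists_rowLen_eq T.wt h.wt_antitone h0
  refine ⟨ν, ?_, fun k => (hν k).symm⟩
  rw [mem_partitionsOf, card_eq_sum_rowLen ν (by rw [hν, h0])]
  exact (Finset.sum_congr rfl fun k _ => hν k).trans (T.sum_wt fun p hp => h.val_lt_card hp)

/-! ### Lattice tableaux of straight shape -/

theorem mem_ferrers {ν : YoungDiagram} {i j : ℕ} : ((i : ℤ), (j : ℤ)) ∈ ferrers ν ↔ (i, j) ∈ ν := by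
  simp only [ferrers, Finset.mem_image, Prod.mk.injEq, Nat.cast_inj]
  constructor
  · rintro ⟨⟨a, b⟩, h, rfl, rfl⟩; exact (YoungDiagram.mem_cells _).1 h
  · intro h; exact ⟨(i, j), (YoungDiagram.mem_cells _).2 h, rfl, rfl⟩

theorem exists_of_mem_ferrers {ν : YoungDiagram} {p : ℤ × ℤ} (h : p ∈ ferrers ν) :
    ∃ i j : ℕ, p = (↑i, ↑j) ∧ (i, j) ∈ ν := by
  simp only [ferrers, Finset.mem_image] at h
  obtain ⟨⟨a, b⟩, h, rfl⟩ := h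
  exact ⟨a, b, rfl, (YoungDiagram.mem_cells _).1 h⟩

theorem card_ferrers (ν : YoungDiagram) : (ferrers ν).card = ν.card := by
  rw [ferrers, Finset.card_image_of_injective]
  rintro ⟨a, b⟩ ⟨c, d⟩ h
  simpa using h

theorem ordConnected_ferrers (ν : YoungDiagram) : (ferrers ν : Set (ℤ × ℤ)).OrdConnected := by
  refine ⟨?_⟩
  rintro p hp q hq ⟨r, x⟩ ⟨h1, h2⟩
  obtain ⟨a, b, rfl, hab⟩ := exists_of_mem_ferrers hp
  obtain ⟨c, d, rfl, hcd⟩ := exists_of_mem_ferrers hq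
  rw [Prod.mk_le_mk] at h1 h2
  obtain ⟨i, rfl⟩ := Int.eq_ofNat_of_zero_le (a := r) (by omega)
  obtain ⟨j, rfl⟩ := Int.eq_ofNat_of_zero_le (a := x) (by omega)
  exact Finset.mem_coe.2 (mem_ferrers.2 (ν.up_left_mem (by omega) (by omega) hcd))

/-- A tableau in which every entry `k + 1` comes with an entry `k` in the same column is a lattice
tableau. -/
theorem SSYT.isLR_of_forall_exists {D : Diagram} {T : SSYT D}
    (h : ∀ p ∈ D, ∀ k, T.val p = k + 1 → ∃ q ∈ D, q.2 = p.2 ∧ T.val q = k) : T.IsLR := by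
  intro c k
  choose! g hg using h
  refine Finset.card_le_card_of_injOn (fun p => g p k) ?_ ?_
  · intro p hp
    simp only [Finset.coe_filter, Set.mem_ofPred_eq] at hp ⊢
    have := hg p hp.1 k hp.2.2
    exact ⟨this.1, this.2.1 ▸ hp.2.1, this.2.2⟩
  · rintro ⟨r, x⟩ hp ⟨s, y⟩ hq hpq
    simp only [Finset.coe_filter, Set.mem_ofPred_eq] at hp hq hpq
    have h1 := (hg _ hp.1 k hp.2.2).2.1
    have h2 := (hg _ hq.1 k hq.2.2).2.1
    rw [hpq] at h1
    simp only at h1 h2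
    obtain rfl : x = y := h1.symm.trans h2
    rw [T.row_eq_of_val_eq hp.1 hq.1 (by rw [hp.2.2, hq.2.2])]

/-- The tableau of straight shape whose `i`-th row consists of entries `i`. -/
def rowTableau (ν : YoungDiagram) : SSYT (ferrers ν) :=
  SSYT.ofFun (fun p => p.1.toNat) (fun _ _ _ _ _ _ => le_rfl) (by
    intro r s x hr hs h
    obtain ⟨a, b, h1, -⟩ := exists_of_mem_ferrers hr
    obtain ⟨c, d, h2, -⟩ := exists_of_mem_ferrers hs
    simp only [Prod.mk.injEq] at h1 h2 ⊢
    omega)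

theorem rowTableau_val {ν : YoungDiagram} {i j : ℕ} (h : (i, j) ∈ ν) :
    (rowTableau ν).val (↑i, ↑j) = i := by
  rw [rowTableau, SSYT.val_ofFun (mem_ferrers.2 h)]
  simp

theorem isLR_rowTableau (ν : YoungDiagram) : (rowTableau ν).IsLR := by
  apply SSYT.isLR_of_forall_exists
  intro p hp k hk
  obtain ⟨i, j, rfl, hij⟩ := exists_of_mem_ferrers hp
  rw [rowTableau_val hij] at hk
  subst hk
  have h := ν.up_left_mem (Nat.le_succ k) le_rfl hij
  exact ⟨(↑k, ↑j), mem_ferrers.2 h, rfl, rowTableau_val h⟩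

theorem wt_rowTableau (ν : YoungDiagram) (k : ℕ) : (rowTableau ν).wt k = ν.rowLen k := by
  rw [SSYT.wt, YoungDiagram.rowLen_eq_card]
  symm
  refine Finset.card_bij (fun p _ => ((p.1 : ℤ), (p.2 : ℤ))) ?_ ?_ ?_
  · rintro ⟨i, j⟩ h
    rw [YoungDiagram.mem_row_iff] at h
    obtain ⟨h, rfl⟩ := h
    exact Finset.mem_filter.2 ⟨mem_ferrers.2 h, rowTableau_val h⟩
  · rintro ⟨i, j⟩ _ ⟨i', j'⟩ _ h
    simpa using h
  · intro p hp
    obtain ⟨hp, hk⟩ := Finset.mem_filter.1 hp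
    obtain ⟨i, j, rfl, hij⟩ := exists_of_mem_ferrers hp
    rw [rowTableau_val hij] at hk
    exact ⟨(i, j), YoungDiagram.mem_row_iff.2 ⟨hij, hk⟩, rfl⟩

/-- Induction from the right, and downwards in each column. Column strictness gives at least i. A
right neighbour bounds the entry by i. At the end of a row, an entry k + 1 > i would need a k weakly
to the right, but boxes further right lie in rows above i and contain their row index, boxes above
in the column have entries less than i, and boxes below have entries greater than k + 1. Here `d`
bounds the distance to the right edge. -/
theorem SSYT.IsLR.val_ferrers {ν : YoungDiagram} {T : SSYT (ferrers ν)} (h : T.IsLR) :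
    ∀ d i j : ℕ, (i, j) ∈ ν → ν.rowLen 0 ≤ j + d → T.val (↑i, ↑j) = i := by
  intro d
  induction d with
  | zero =>
    intro i j hij hd
    have := YoungDiagram.mem_iff_lt_rowLen.1 (ν.up_left_mem (Nat.zero_le i) le_rfl hij)
    omega
  | succ d ih =>
    intro i
    induction i using Nat.strong_induction_on with
    | _ i ihi =>
    intro j hij hd
    have hge : i ≤ T.val (↑i, ↑j) := by
      rcases Nat.eq_zero_or_pos i with h0 | h0
      · omega
      · have hm : (i - 1, j) ∈ ν := ν.up_left_mem (Nat.sub_le _ _) le_rfl hij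
        have h1 := T.val_col (mem_ferrers.2 hm) (mem_ferrers.2 hij) (by omega)
        rw [ihi (i - 1) (by omega) j hm hd] at h1
        omega
    by_cases hr : (i, j + 1) ∈ ν
    · have h1 := T.val_row (mem_ferrers.2 hij) (mem_ferrers.2 hr) (by push_cast; omega)
      rw [ih i (j + 1) hr (by omega)] at h1
      omega
    by_contra hne
    obtain ⟨k, hk⟩ : ∃ k, T.val (↑i, ↑j) = k + 1 := ⟨T.val (↑i, ↑j) - 1, by omega⟩
    have h1 : 0 < T.cnt j (k + 1) :=
      Finset.card_pos.2 ⟨(↑i, ↑j), by simp [mem_ferrers.2 hij, hk]⟩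
    obtain ⟨q, hq⟩ := Finset.card_pos.1 (h1.trans_le (h j k))
    obtain ⟨hq, hqj, hqk⟩ := Finset.mem_filter.1 hq
    obtain ⟨a, b, rfl, hab⟩ := exists_of_mem_ferrers hq
    simp only [Nat.cast_le] at hqj
    rcases hqj.eq_or_lt with rfl | hlt
    · have hai : a < i := by
        by_contra hai
        rcases (not_lt.1 hai).eq_or_lt with rfl | hai
        · omega
        · have := T.val_col (mem_ferrers.2 hij) (mem_ferrers.2 hab) (by omega)
          omega
      rw [ihi a hai j hab hd] at hqk
      omega
    · rw [ih a b hab (by omega)] at hqk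
      exact hr (ν.up_left_mem (by omega) (by omega) hab)

theorem SSYT.IsLR.eq_rowTableau {ν : YoungDiagram} {T : SSYT (ferrers ν)} (h : T.IsLR) :
    T = rowTableau ν := by
  apply SSYT.ext_val
  intro p hp
  obtain ⟨i, j, rfl, hij⟩ := exists_of_mem_ferrers hp
  rw [rowTableau_val hij, h.val_ferrers (ν.rowLen 0) i j hij (by omega)]

/-! ### The Littlewood-Richardson rule -/

/-- The lattice tableaux of shape `D` with content `ν`. -/
abbrev LRTab (D : Diagram) (ν : YoungDiagram) := {T : SSYT D // T.IsLR ∧ ∀ k, T.wt k = ν.rowLen k}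

instance (D : Diagram) (ν : YoungDiagram) : Finite (LRTab D ν) :=
  Finite.of_injective (fun T : LRTab D ν => (⟨T.1, fun _ hp => T.2.1.val_lt_card hp⟩ :
    BddSSYT D D.card)) fun _ _ h => Subtype.ext (congrArg (fun x => x.1) h)

/-- The number of lattice tableaux of shape `D` with content `ν`. -/
def lrNum (D : Diagram) (ν : YoungDiagram) : ℕ := Nat.card (LRTab D ν)

theorem alternant_mul_schurPoly_ferrers (ν : YoungDiagram) {n : ℕ} (hn : ν.card ≤ n) :
    alternant (staircase (n := n)) * schurPoly n (ferrers ν) =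
      alternant (fun i : Fin n => staircase i + ν.rowLen i) := by
  classical
  rw [alternant_mul_schurPoly_eq_sum_isLR (ordConnected_ferrers ν)]
  have hlt : ∀ p ∈ ferrers ν, (rowTableau ν).val p < n := fun p hp =>
    ((isLR_rowTableau ν).val_lt_card hp).trans_le (by rwa [card_ferrers])
  rw [Finset.sum_eq_single_of_mem (⟨rowTableau ν, hlt⟩ : BddSSYT (ferrers ν) n)]
  · simp only [wt_rowTableau]
  · exact Finset.mem_filter.2 ⟨Finset.mem_univ _, isLR_rowTableau ν⟩
  · intro T hT hne
    exact absurd (Subtype.ext (Finset.mem_filter.1 hT).2.eq_rowTableau) hne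

theorem alternant_mul_schurPoly_eq_sum {D : Diagram} (hD : (D : Set (ℤ × ℤ)).OrdConnected)
    {n : ℕ} (hn : D.card ≤ n) :
    alternant (staircase (n := n)) * schurPoly n D = ∑ ν ∈ partitionsOf D.card,
      (lrNum D ν : ℤ) • alternant (fun i : Fin n => staircase i + ν.rowLen i) := by
  classical
  rw [alternant_mul_schurPoly_eq_sum_isLR hD]
  have hex : ∀ T : SSYT D, ∃ ν : YoungDiagram, T.IsLR →
      ν ∈ partitionsOf D.card ∧ ∀ k, T.wt k = ν.rowLen k := fun T => by
    by_cases h : T.IsLR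
    · obtain ⟨ν, h1, h2⟩ := h.exists_shape
      exact ⟨ν, fun _ => ⟨h1, h2⟩⟩
    · exact ⟨⊥, fun h' => absurd h' h⟩
  choose sh hsh using hex
  rw [← Finset.sum_fiberwise_of_maps_to (t := partitionsOf D.card)
    (g := fun T : BddSSYT D n => sh T.1) (fun T hT => (hsh T.1 (Finset.mem_filter.1 hT).2).1)]
  refine Finset.sum_congr rfl fun ν _ => ?_
  have hcard : lrNum D ν =
      (((Finset.univ.filter fun T : BddSSYT D n => T.1.IsLR)).filter fun T => sh T.1 = ν).card := by
    rw [lrNum, ← Fintype.card_coe, ← Nat.card_eq_fintype_card]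
    refine Nat.card_congr ⟨fun T => ⟨⟨T.1, fun p hp => (T.2.1.val_lt_card hp).trans_le hn⟩, ?_⟩,
      fun T => ⟨T.1.1, ?_⟩, fun _ => rfl, fun _ => rfl⟩
    · refine Finset.mem_filter.2 ⟨Finset.mem_filter.2 ⟨Finset.mem_univ _, T.2.1⟩, ?_⟩
      exact youngDiagram_ext_rowLen fun k => by rw [← (hsh T.1 T.2.1).2, T.2.2]
    · have h1 := Finset.mem_filter.1 T.2
      have h2 := (Finset.mem_filter.1 h1.1).2
      exact ⟨h2, fun k => by rw [(hsh T.1.1 h2).2, h1.2]⟩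
  rw [hcard, Nat.cast_smul_eq_nsmul, ← Finset.sum_const]
  refine Finset.sum_congr rfl fun T hT => ?_
  obtain ⟨hT', rfl⟩ := Finset.mem_filter.1 hT
  simp only [(hsh T.1 (Finset.mem_filter.1 hT').2).2]

theorem schurPoly_eq_sum {D : Diagram} (hD : (D : Set (ℤ × ℤ)).OrdConnected)
    {n : ℕ} (hn : D.card ≤ n) :
    schurPoly n D = ∑ ν ∈ partitionsOf D.card, (lrNum D ν : ℤ) • schurPoly n (ferrers ν) := by
  apply mul_left_cancel₀ (alternant_staircase_ne_zero n)
  rw [alternant_mul_schurPoly_eq_sum hD hn, Finset.mul_sum]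
  refine Finset.sum_congr rfl fun ν hν => ?_
  rw [mul_smul_comm, alternant_mul_schurPoly_ferrers ν (by rwa [mem_partitionsOf.1 hν])]

/-- Truncation to n variables loses nothing for a monomial in those variables: a tableau with that
content automatically has entries below n. This transfers identities between polynomials and power
series. -/
theorem coeff_schurPoly (D : Diagram) {n : ℕ} (d : Fin n →₀ ℕ) :
    MvPolynomial.coeff d (schurPoly n D) = skewSchur D (d.embDomain Fin.valEmbedding) := by
  classical
  have hmon : ∀ u : Fin n → ℕ, (∏ i, MvPolynomial.X i ^ u i : MvPolynomial (Fin n) ℤ) =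
      MvPolynomial.monomial (Finsupp.equivFunOnFinite.symm u) 1 := by
    intro u
    rw [MvPolynomial.monomial_eq, Finsupp.prod_fintype _ _ (fun i => pow_zero _)]
    simp
  simp only [schurPoly, hmon, MvPolynomial.coeff_sum, MvPolynomial.coeff_monomial]
  rw [Finset.sum_boole, skewSchur, Nat.cast_inj, ← Fintype.card_subtype, ← Nat.card_eq_fintype_card]
  have hiff : ∀ T : BddSSYT D n, Finsupp.equivFunOnFinite.symm (fun i : Fin n => T.1.wt i) = d ↔
      T.1.content = d.embDomain Fin.valEmbedding := by
    intro T
    rw [Finsupp.ext_iff, Finsupp.ext_iff]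
    constructor
    · intro h k
      rw [SSYT.content_apply]
      by_cases hk : k < n
      · have h1 := h ⟨k, hk⟩
        have h2 := Finsupp.embDomain_apply_self Fin.valEmbedding d ⟨k, hk⟩
        simp only [Fin.valEmbedding_apply] at h2
        rw [h2, ← h1]
        rfl
      · rw [T.1.wt_eq_zero T.2 (not_lt.1 hk), Finsupp.embDomain_of_notMem_range]
        rintro ⟨i, rfl⟩
        exact hk i.2
    · intro h i
      have h1 := h i
      have h2 := Finsupp.embDomain_apply_self Fin.valEmbedding d i
      simp only [Fin.valEmbedding_apply] at h2
      rw [h2, SSYT.content_apply] at h1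
      rw [← h1]
      rfl
  refine Nat.card_congr ⟨fun T => ⟨T.1.1, (hiff T.1).1 T.2⟩, fun T => ⟨⟨T.1, ?_⟩, ?_⟩, ?_, ?_⟩
  · intro p hp
    by_contra hlt
    have h1 := T.1.wt_val_pos hp
    rw [← T.1.content_apply, T.2, Finsupp.embDomain_of_notMem_range] at h1
    · omega
    · rintro ⟨i, hi⟩
      simp only [Fin.valEmbedding_apply] at hi
      omega
  · exact (hiff ⟨T.1, _⟩).2 T.2
  · intro T; rfl
  · intro T; rfl

theorem coeff_sum_smul {ι : Type*} (s : Finset ι) (a : ι → ℤ) (f : ι → MvPowerSeries ℕ ℤ)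
    (m : ℕ →₀ ℕ) : (∑ i ∈ s, a i • f i) m = ∑ i ∈ s, a i * f i m := by
  change MvPowerSeries.coeff m (∑ i ∈ s, a i • f i) = _
  rw [map_sum]
  refine Finset.sum_congr rfl fun i _ => ?_
  rw [map_zsmul, smul_eq_mul]
  rfl

/-- **Littlewood-Richardson rule**: the coefficient of `s_ν` in `s_D` is the number of lattice
tableaux of shape `D` with content `ν`. -/
theorem skewSchur_eq_sum_lrNum {D : Diagram} (hD : (D : Set (ℤ × ℤ)).OrdConnected) :
    skewSchur D = ∑ ν ∈ partitionsOf D.card, (lrNum D ν : ℤ) • schur ν := by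
  funext m
  rw [coeff_sum_smul]
  -- Enough variables both for the polynomial identity and for the monomial under consideration.
  obtain ⟨n, hn, hsupp⟩ : ∃ n, D.card ≤ n ∧ ∀ k ∈ m.support, k < n := by
    refine ⟨D.card + m.support.sup id + 1, by omega, fun k hk => ?_⟩
    have : k ≤ m.support.sup id := Finset.le_sup (f := id) hk
    omega
  obtain ⟨d, rfl⟩ : ∃ d : Fin n →₀ ℕ, m = d.embDomain Fin.valEmbedding := by
    refine ⟨m.comapDomain Fin.valEmbedding Fin.valEmbedding.injective.injOn, ?_⟩
    rw [Finsupp.embDomain_comapDomain]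
    intro k hk
    exact ⟨⟨k, hsupp k hk⟩, rfl⟩
  rw [← coeff_schurPoly, schurPoly_eq_sum hD hn, MvPolynomial.coeff_sum]
  refine Finset.sum_congr rfl fun ν _ => ?_
  rw [MvPolynomial.coeff_smul, coeff_schurPoly, smul_eq_mul, schur]

/-! ### Linear independence of Schur functions -/

/-- Among the rearrangements of a strictly decreasing sequence only the sequence itself is strictly
decreasing, so an alternant has exactly one monomial with strictly decreasing exponents. -/
theorem coeff_alternant {n : ℕ} {β γ : Fin n → ℕ} (hβ : StrictAnti β) (hγ : StrictAnti γ) :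
    MvPolynomial.coeff (Finsupp.equivFunOnFinite.symm γ) (alternant β) = if β = γ then 1 else 0 := by
  classical
  have hmon : ∀ σ : Equiv.Perm (Fin n),
      (∏ i, MvPolynomial.X (σ i) ^ β i : MvPolynomial (Fin n) ℤ) =
      MvPolynomial.monomial (Finsupp.equivFunOnFinite.symm (β ∘ σ.symm)) 1 := by
    intro σ
    rw [MvPolynomial.monomial_eq, Finsupp.prod_fintype _ _ (fun i => pow_zero _), map_one, one_mul,
      ← Equiv.prod_comp σ (fun i => MvPolynomial.X i ^ _)]
    simp
  rw [alternant, Matrix.det_apply]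
  simp only [Matrix.of_apply, hmon, MvPolynomial.coeff_sum]
  have hσ : ∀ σ : Equiv.Perm (Fin n), β ∘ σ.symm = γ → σ = 1 := by
    intro σ h
    have hm : StrictMono σ.symm := fun i j hij => by
      have := hγ hij
      rw [← h] at this
      exact hβ.lt_iff_gt.1 this
    ext i
    have h2 := Fin.coe_orderIso_apply (hm.orderIsoOfSurjective _ σ.symm.surjective) (σ i)
    simpa using h2.symm
  rw [Finset.sum_eq_single 1]
  · rw [Equiv.Perm.sign_one, one_smul, MvPolynomial.coeff_monomial]
    congr 1
    simp only [Finsupp.equivFunOnFinite.symm.injective.eq_iff, eq_iff_iff]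
    exact Iff.rfl
  · intro σ _ hne
    rw [Units.smul_def, MvPolynomial.coeff_smul, MvPolynomial.coeff_monomial, if_neg, smul_zero]
    intro h
    exact hne (hσ σ (Finsupp.equivFunOnFinite.symm.injective h))
  · intro h
    exact absurd (Finset.mem_univ _) h

theorem strictAnti_staircase_add (ν : YoungDiagram) (n : ℕ) :
    StrictAnti (fun i : Fin n => staircase i + ν.rowLen i) := by
  intro i j hij
  have := ν.rowLen_anti i j (le_of_lt hij)
  simp only [staircase]
  have := j.2
  omega

/-- In enough variables, multiplication by the staircase alternant turns s_ν into the alternant of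
staircase + ν. The coefficient of the monomial with exponents staircase + μ then isolates the
coefficient of s_μ. -/
theorem schur_linearIndependent {P : Finset YoungDiagram} {a b : YoungDiagram → ℤ}
    (h : ∑ ν ∈ P, a ν • schur ν = ∑ ν ∈ P, b ν • schur ν) : ∀ ν ∈ P, a ν = b ν := by
  classical
  set n := P.sup YoungDiagram.card with hn
  have hcard : ∀ ν ∈ P, ν.card ≤ n := fun ν hν => Finset.le_sup hν
  have key : ∀ c : YoungDiagram → ℤ, ∀ d : Fin n →₀ ℕ,
      (∑ ν ∈ P, c ν • schur ν) (d.embDomain Fin.valEmbedding) =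
      MvPolynomial.coeff d (∑ ν ∈ P, c ν • schurPoly n (ferrers ν)) := by
    intro c d
    rw [coeff_sum_smul, MvPolynomial.coeff_sum]
    refine Finset.sum_congr rfl fun ν _ => ?_
    rw [MvPolynomial.coeff_smul, coeff_schurPoly, smul_eq_mul, schur]
  have h1 : ∑ ν ∈ P, a ν • schurPoly n (ferrers ν) = ∑ ν ∈ P, b ν • schurPoly n (ferrers ν) := by
    ext d
    rw [← key, ← key, h]
  have h2 : ∀ c : YoungDiagram → ℤ, alternant (staircase (n := n)) *
      ∑ ν ∈ P, c ν • schurPoly n (ferrers ν) =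
      ∑ ν ∈ P, c ν • alternant (fun i : Fin n => staircase i + ν.rowLen i) := by
    intro c
    rw [Finset.mul_sum]
    refine Finset.sum_congr rfl fun ν hν => ?_
    rw [mul_smul_comm, alternant_mul_schurPoly_ferrers ν (hcard ν hν)]
  have h3 : ∀ c : YoungDiagram → ℤ, ∀ μ ∈ P,
      MvPolynomial.coeff (Finsupp.equivFunOnFinite.symm
        (fun i : Fin n => staircase i + μ.rowLen i))
      (∑ ν ∈ P, c ν • alternant (fun i : Fin n => staircase i + ν.rowLen i)) = c μ := by
    intro c μ hμ
    rw [MvPolynomial.coeff_sum, Finset.sum_eq_single_of_mem μ hμ]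
    · rw [MvPolynomial.coeff_smul, coeff_alternant (strictAnti_staircase_add _ _)
        (strictAnti_staircase_add _ _), if_pos rfl, smul_eq_mul, mul_one]
    · intro ν hν hne
      rw [MvPolynomial.coeff_smul, coeff_alternant (strictAnti_staircase_add _ _)
        (strictAnti_staircase_add _ _), if_neg, smul_zero]
      intro heq
      apply hne
      apply youngDiagram_ext_rowLen
      intro i
      by_cases hi : i < n
      · have := congrFun heq ⟨i, hi⟩
        simpa using this
      · have e1 := ν.rowLen_anti ν.card i ((hcard ν hν).trans (not_lt.1 hi))
        have e2 := μ.rowLen_anti μ.card i ((hcard μ hμ).trans (not_lt.1 hi))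
        rw [rowLen_card] at e1 e2
        omega
  intro μ hμ
  rw [← h3 a μ hμ, ← h2, h1, h2, h3 b μ hμ]

/-! ### Restriction of tableaux, and counting lattice tableaux by restriction -/

/-- The restriction of a tableau to a smaller diagram. -/
def SSYT.restrict {D S : Diagram} (h : D ⊆ S) (T : SSYT S) : SSYT D :=
  SSYT.ofFun T.val (fun _ _ _ hx hy hxy => T.val_row (h hx) (h hy) hxy.le)
    (fun _ _ _ hr hs hrs => T.val_col (h hr) (h hs) hrs)

theorem SSYT.val_restrict {D S : Diagram} {h : D ⊆ S} {T : SSYT S} {p : ℤ × ℤ} (hp : p ∈ D) :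
    (T.restrict h).val p = T.val p := SSYT.val_ofFun hp

theorem SSYT.cnt_restrict {D S : Diagram} {h : D ⊆ S} {T : SSYT S} (c : ℤ) (k : ℕ) :
    (T.restrict h).cnt c k = (D.filter (fun p => c ≤ p.2 ∧ T.val p = k)).card := by
  rw [SSYT.cnt]
  congr 1
  exact Finset.filter_congr fun p hp => by rw [SSYT.val_restrict hp]

theorem SSYT.wt_restrict {D S : Diagram} {h : D ⊆ S} {T : SSYT S} (k : ℕ) :
    (T.restrict h).wt k = (D.filter (fun p => T.val p = k)).card := by
  rw [SSYT.wt]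
  congr 1
  exact Finset.filter_congr fun p hp => by rw [SSYT.val_restrict hp]

theorem SSYT.cnt_restrict_le {D S : Diagram} {h : D ⊆ S} {T : SSYT S} (c : ℤ) (k : ℕ) :
    (T.restrict h).cnt c k ≤ T.cnt c k := by
  rw [SSYT.cnt_restrict]
  exact Finset.card_le_card (Finset.filter_subset_filter _ h)

/-- The lattice tableaux of shape `D` whose content has the property `Q`. -/
abbrev LRTabWith (D : Diagram) (Q : (ℕ → ℕ) → Prop) := {T : SSYT D // T.IsLR ∧ Q T.wt}

instance (D : Diagram) (Q : (ℕ → ℕ) → Prop) : Finite (LRTabWith D Q) :=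
  Finite.of_injective (fun T : LRTabWith D Q => (⟨T.1, fun _ hp => T.2.1.val_lt_card hp⟩ :
    BddSSYT D D.card)) fun _ _ h => Subtype.ext (congrArg (fun x => x.1) h)

-- Restriction maps produce tableaux on D subject to a condition on their content. Sorting these by
-- content expresses their number through the coefficients of s_D.
open Classical in
theorem card_LRTabWith (D : Diagram) (Q : (ℕ → ℕ) → Prop) :
    Nat.card (LRTabWith D Q) =
      ∑ ν ∈ partitionsOf D.card, if Q ν.rowLen then lrNum D ν else 0 := by
  have := Fintype.ofFinite (LRTabWith D Q)
  choose sh hsh using fun T : LRTabWith D Q => T.2.1.exists_shape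
  rw [Nat.card_eq_fintype_card, ← Finset.card_univ,
    Finset.card_eq_sum_card_fiberwise (f := sh) (t := partitionsOf D.card) (fun T _ => (hsh T).1)]
  refine Finset.sum_congr rfl fun ν _ => ?_
  split_ifs with hQ
  · rw [lrNum, ← Fintype.card_coe, ← Nat.card_eq_fintype_card]
    have hw : ∀ T : LRTab D ν, T.1.wt = ν.rowLen := fun T => funext T.2.2
    refine Nat.card_congr ⟨fun T => ⟨T.1.1, T.1.2.1, fun k => ?_⟩,
      fun T => ⟨⟨T.1, T.2.1, by rwa [hw]⟩, ?_⟩, fun _ => rfl, fun _ => rfl⟩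
    · rw [(hsh T.1).2, (Finset.mem_filter.1 T.2).2]
    · refine Finset.mem_filter.2 ⟨Finset.mem_univ _, ?_⟩
      exact youngDiagram_ext_rowLen fun k => by rw [← (hsh _).2, T.2.2]
  · rw [Finset.card_eq_zero, Finset.filter_eq_empty_iff]
    rintro T - rfl
    apply hQ
    have := T.2.2
    rwa [show T.1.wt = (sh T).rowLen from funext (hsh T).2] at this

/-! ### Attaching boxes to a diagram -/

/-- The diagram obtained by adding the boxes `r 0, …, r (m - 1)`. -/
def attach (D : Diagram) (r : ℕ → ℤ × ℤ) (m : ℕ) : Diagram := D ∪ (Finset.range m).image r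

theorem subset_attach (D : Diagram) (r : ℕ → ℤ × ℤ) (m : ℕ) : D ⊆ attach D r m :=
  Finset.subset_union_left

theorem mem_attach_right (D : Diagram) (r : ℕ → ℤ × ℤ) {m j : ℕ} (h : j < m) : r j ∈ attach D r m :=
  Finset.mem_union_right _ (Finset.mem_image_of_mem _ (Finset.mem_range.2 h))

theorem mem_attach {D : Diagram} {r : ℕ → ℤ × ℤ} {m : ℕ} {p : ℤ × ℤ} :
    p ∈ attach D r m ↔ p ∈ D ∨ ∃ j < m, r j = p := by
  simp [attach]

theorem card_filter_attach {D : Diagram} {r : ℕ → ℤ × ℤ} (hr : Function.Injective r)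
    (hrD : ∀ j, r j ∉ D) (m : ℕ) (P : ℤ × ℤ → Prop) [DecidablePred P] :
    ((attach D r m).filter P).card =
      (D.filter P).card + ((Finset.range m).filter (fun j => P (r j))).card := by
  rw [attach, Finset.filter_union, Finset.card_union_of_disjoint, Finset.filter_image,
    Finset.card_image_of_injective _ hr]
  rw [Finset.disjoint_left]
  intro p hp hq
  simp only [Finset.mem_filter, Finset.mem_image] at hp hq
  obtain ⟨⟨j, -, rfl⟩, -⟩ := hq
  exact hrD j hp.1

theorem card_attach {D : Diagram} {r : ℕ → ℤ × ℤ} (hr : Function.Injective r)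
    (hrD : ∀ j, r j ∉ D) (m : ℕ) : (attach D r m).card = D.card + m := by
  have := card_filter_attach hr hrD m (fun _ => True)
  simpa using this

theorem wt_attach {D : Diagram} {r : ℕ → ℤ × ℤ} (hr : Function.Injective r)
    (hrD : ∀ j, r j ∉ D) {m : ℕ} (T : SSYT (attach D r m)) (k : ℕ) :
    T.wt k = (T.restrict (subset_attach D r m)).wt k +
      ((Finset.range m).filter (fun j => T.val (r j) = k)).card := by
  rw [SSYT.wt_restrict, SSYT.wt, card_filter_attach hr hrD]

theorem cnt_attach {D : Diagram} {r : ℕ → ℤ × ℤ} (hr : Function.Injective r)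
    (hrD : ∀ j, r j ∉ D) {m : ℕ} (T : SSYT (attach D r m)) (c : ℤ) (k : ℕ) :
    T.cnt c k = (T.restrict (subset_attach D r m)).cnt c k +
      ((Finset.range m).filter (fun j => c ≤ (r j).2 ∧ T.val (r j) = k)).card := by
  rw [SSYT.cnt_restrict, SSYT.cnt, card_filter_attach hr hrD]

/-- A finite weakly increasing sequence is determined by the multiplicities of its values. -/
theorem eq_of_monotone_of_card_eq {m : ℕ} {f g : ℕ → ℕ}
    (hf : ∀ i j, i ≤ j → j < m → f i ≤ f j) (hg : ∀ i j, i ≤ j → j < m → g i ≤ g j)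
    (h : ∀ k, ((Finset.range m).filter (fun j => f j = k)).card =
      ((Finset.range m).filter (fun j => g j = k)).card) :
    ∀ i < m, f i = g i := by
  have hle : ∀ (f : ℕ → ℕ) (v : ℕ), ((Finset.range m).filter (fun j => f j ≤ v)).card =
      ∑ k ∈ Finset.range (v + 1), ((Finset.range m).filter (fun j => f j = k)).card := by
    intro f v
    rw [Finset.card_eq_sum_card_fiberwise (f := f) (t := Finset.range (v + 1))]
    · refine Finset.sum_congr rfl fun k hk => ?_
      rw [Finset.filter_filter]
      congr 1
      refine Finset.filter_congr fun j _ => ?_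
      have := Finset.mem_range.1 hk
      omega
    · intro j hj
      simp only [Finset.coe_filter, Set.mem_ofPred_eq, Finset.coe_range, Set.mem_Iio] at hj ⊢
      omega
  have key : ∀ f g : ℕ → ℕ, (∀ i j, i ≤ j → j < m → f i ≤ f j) →
      (∀ i j, i ≤ j → j < m → g i ≤ g j) →
      (∀ k, ((Finset.range m).filter (fun j => f j = k)).card =
      ((Finset.range m).filter (fun j => g j = k)).card) → ∀ i < m, ¬ f i < g i := by
    -- If f i < g i, at least i + 1 values of f but at most i values of g are ≤ f i, contrary to
    -- equal multiplicities.
    intro f g hf hg h i hi hlt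
    have h1 : Finset.range (i + 1) ⊆ (Finset.range m).filter (fun j => f j ≤ f i) := by
      intro j hj
      rw [Finset.mem_range] at hj
      exact Finset.mem_filter.2 ⟨Finset.mem_range.2 (by omega), hf j i (by omega) hi⟩
    have h2 : (Finset.range m).filter (fun j => g j ≤ f i) ⊆ Finset.range i := by
      intro j hj
      rw [Finset.mem_filter, Finset.mem_range] at hj
      rw [Finset.mem_range]
      by_contra hji
      have := hg i j (by omega) hj.1
      omega
    have h3 := Finset.card_le_card h1
    have h4 := Finset.card_le_card h2
    rw [Finset.card_range] at h3 h4
    rw [hle, Finset.sum_congr rfl fun k _ => h k, ← hle] at h3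
    omega
  intro i hi
  have h1 := key f g hf hg h i hi
  have h2 := key g f hg hf (fun k => (h k).symm) i hi
  omega

/-- A tableau on a diagram with attached boxes, along which the entries weakly increase, is
determined by its restriction and its content. -/
theorem eq_of_restrict_eq {D : Diagram} {r : ℕ → ℤ × ℤ} (hr : Function.Injective r)
    (hrD : ∀ j, r j ∉ D) {m : ℕ} {T T' : SSYT (attach D r m)}
    (hT : ∀ i j, i ≤ j → j < m → T.val (r i) ≤ T.val (r j))
    (hT' : ∀ i j, i ≤ j → j < m → T'.val (r i) ≤ T'.val (r j))
    (hwt : ∀ k, T.wt k = T'.wt k)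
    (hres : T.restrict (subset_attach D r m) = T'.restrict (subset_attach D r m)) : T = T' := by
  have h := eq_of_monotone_of_card_eq hT hT' fun k => by
    have h1 := wt_attach hr hrD T k
    have h2 := wt_attach hr hrD T' k
    rw [hres] at h1
    have := hwt k
    omega
  apply SSYT.ext_val
  intro p hp
  rcases mem_attach.1 hp with hp | ⟨j, hj, rfl⟩
  · rw [← SSYT.val_restrict (h := subset_attach D r m) hp, hres, SSYT.val_restrict hp]
  · exact h j hj

/-- `μ / ν` has at most one box in each row. -/
def IsVerticalStrip (μ ν : ℕ → ℕ) : Prop := ∀ k, ν k ≤ μ k ∧ μ k ≤ ν k + 1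

/-- `μ / ν` has at most one box in each row and in each column. -/
def IsDoubleStrip (μ ν : ℕ → ℕ) : Prop := IsVerticalStrip μ ν ∧ ∀ k, μ (k + 1) ≤ ν k

/-- The rows that contain a box of a vertical strip, in increasing order. -/
theorem exists_enum_verticalStrip {μ ν : YoungDiagram} (h : IsVerticalStrip μ.rowLen ν.rowLen)
    {m : ℕ} (hm : μ.card = ν.card + m) :
    ∃ e : ℕ → ℕ, (∀ i j, i < j → j < m → e i < e j) ∧
      ∀ k, ν.rowLen k + ((Finset.range m).filter (fun j => e j = k)).card = μ.rowLen k := by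
  set E := (Finset.range μ.card).filter (fun k => μ.rowLen k = ν.rowLen k + 1) with hE
  have h0 := rowLen_card μ
  have h1 : ν.rowLen μ.card = 0 := by
    have := (h μ.card).1
    omega
  -- Each row of the strip contributes at most one box, so the number of rows met equals the
  -- difference in size.
  have hcard : E.card = m := by
    rw [hE, Finset.card_filter]
    have h2 := card_eq_sum_rowLen μ h0
    have h3 := card_eq_sum_rowLen ν h1
    have h4 : ∑ k ∈ Finset.range μ.card, μ.rowLen k = ∑ k ∈ Finset.range μ.card, ν.rowLen k +
        ∑ k ∈ Finset.range μ.card, if μ.rowLen k = ν.rowLen k + 1 then 1 else 0 := by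
      rw [← Finset.sum_add_distrib]
      refine Finset.sum_congr rfl fun k _ => ?_
      have := h k
      split_ifs <;> omega
    omega
  let e : ℕ → ℕ := fun j => if hj : j < m then E.orderEmbOfFin hcard ⟨j, hj⟩ else 0
  have he : ∀ j (hj : j < m), e j = E.orderEmbOfFin hcard ⟨j, hj⟩ := fun j hj => dif_pos hj
  have hmono : ∀ i j, i < j → j < m → e i < e j := by
    intro i j hij hj
    rw [he i (hij.trans hj), he j hj]
    simpa using hij
  refine ⟨e, hmono, fun k => ?_⟩
  have hle : ((Finset.range m).filter (fun j => e j = k)).card ≤ 1 := by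
    rw [Finset.card_le_one]
    intro i hi j hj
    simp only [Finset.mem_filter, Finset.mem_range] at hi hj
    rcases lt_trichotomy i j with hlt | heq | hgt
    · have := hmono i j hlt hj.1; omega
    · exact heq
    · have := hmono j i hgt hi.1; omega
  have hpos : 0 < ((Finset.range m).filter (fun j => e j = k)).card ↔ k ∈ E := by
    rw [Finset.card_pos]
    constructor
    · rintro ⟨j, hj⟩
      simp only [Finset.mem_filter, Finset.mem_range] at hj
      rw [← hj.2, he j hj.1]
      exact Finset.orderEmbOfFin_mem _ _ _
    · intro hk
      have : k ∈ Set.range (E.orderEmbOfFin hcard) := by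
        rw [Finset.range_orderEmbOfFin]; exact hk
      obtain ⟨i, hi⟩ := this
      exact ⟨i, Finset.mem_filter.2 ⟨Finset.mem_range.2 i.2, by rw [he i i.2, ← hi]⟩⟩
  have hk := h k
  have hiff : k ∈ E ↔ μ.rowLen k = ν.rowLen k + 1 := by
    rw [hE, Finset.mem_filter, Finset.mem_range]
    refine ⟨fun h => h.2, fun h' => ⟨?_, h'⟩⟩
    by_contra hlt
    have := μ.rowLen_anti _ _ (not_lt.1 hlt)
    omega
  rw [hiff] at hpos
  omega

/-! ### Diagrams with a last row -/

/-- `D` is a skew diagram above row `L + 1`, whose boxes in row `L` are the `l` boxes from column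
`a` on, and which has no boxes to the left of column `a`. -/
structure HasLastRow (D : Diagram) (L a : ℤ) (l : ℕ) : Prop where
  ordConnected : (D : Set (ℤ × ℤ)).OrdConnected
  row_le : ∀ p ∈ D, p.1 ≤ L
  le_col : ∀ p ∈ D, a ≤ p.2
  mem_iff : ∀ x, (L, x) ∈ D ↔ a ≤ x ∧ x < a + l

/-- In a lattice tableau, the entries `k + 1` are at most as many as the entries `k` above the last
row. -/
theorem SSYT.IsLR.cnt_succ_le_cnt_restrict {S D : Diagram} {L a : ℤ} {l : ℕ}
    (hS : HasLastRow S L a l) (hDS : D ⊆ S) (hD : ∀ p ∈ S, p.1 < L → p ∈ D) {T : SSYT S}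
    (hT : T.IsLR) (c : ℤ) (k : ℕ) : T.cnt c (k + 1) ≤ (T.restrict hDS).cnt c k := by
  -- If the last row has only entries above k from column c' on, every k there lies in D.
  have hfree : ∀ c', c ≤ c' → (∀ x, c' ≤ x → (L, x) ∈ S → k < T.val (L, x)) →
      T.cnt c' k ≤ (T.restrict hDS).cnt c k := by
    intro c' hc' h
    rw [SSYT.cnt, SSYT.cnt_restrict]
    refine Finset.card_le_card ?_
    rintro ⟨r, x⟩ hp
    obtain ⟨hp, hx, hk⟩ := Finset.mem_filter.1 hp
    refine Finset.mem_filter.2 ⟨hD _ hp ?_, hc'.trans hx, hk⟩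
    refine lt_of_le_of_ne (hS.row_le _ hp) fun hr => ?_
    simp only at hr
    subst hr
    have := h x hx hp
    omega
  by_cases hex : ∃ x, c ≤ x ∧ (L, x) ∈ S ∧ T.val (L, x) ≤ k
  · obtain ⟨b, ⟨hcb, hb, hbk⟩, hmax⟩ := Int.exists_greatest_of_bdd
      (P := fun x => c ≤ x ∧ (L, x) ∈ S ∧ T.val (L, x) ≤ k)
      ⟨a + l, fun z hz => ((hS.mem_iff z).1 hz.2.1).2.le⟩ hex
    -- Columns from c up to b contain no k + 1: each of them reaches the last row, where its entry
    -- is at most k. So the lattice condition may be applied at b + 1 instead, where the last row is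
    -- harmless.
    have h1 : T.cnt c (k + 1) ≤ T.cnt (b + 1) (k + 1) := by
      refine Finset.card_le_card ?_
      rintro ⟨r, x⟩ hp
      obtain ⟨hp, hx, hk⟩ := Finset.mem_filter.1 hp
      refine Finset.mem_filter.2 ⟨hp, ?_, hk⟩
      by_contra hlt
      simp only [not_le] at hlt
      have hxL : (L, x) ∈ S := (hS.mem_iff x).2 ⟨hS.le_col _ hp, by
        have := ((hS.mem_iff b).1 hb).2; omega⟩
      have h2 := T.val_row hxL hb (by omega)
      have h3 : T.val (r, x) ≤ T.val (L, x) := by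
        rcases (hS.row_le _ hp).eq_or_lt with h | h
        · simp only at h; rw [h]
        · exact (T.val_col hp hxL h).le
      omega
    refine h1.trans ((hT (b + 1) k).trans (hfree (b + 1) (by omega) fun x hx hxS => ?_))
    by_contra hlt
    have := hmax x ⟨by omega, hxS, by omega⟩
    omega
  · refine (hT c k).trans (hfree c le_rfl fun x hx hxS => ?_)
    by_contra hlt
    exact hex ⟨x, hx, hxS, by omega⟩

theorem SSYT.IsLR.wt_succ_le_wt_restrict {S D : Diagram} {L a : ℤ} {l : ℕ}
    (hS : HasLastRow S L a l) (hDS : D ⊆ S) (hD : ∀ p ∈ S, p.1 < L → p ∈ D) {T : SSYT S}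
    (hT : T.IsLR) (k : ℕ) : T.wt (k + 1) ≤ (T.restrict hDS).wt k := by
  have h := hT.cnt_succ_le_cnt_restrict hS hDS hD a k
  rwa [SSYT.cnt_eq_wt _ hS.le_col, SSYT.cnt_eq_wt _ fun p hp => hS.le_col p (hDS hp)] at h

/-- Removing the last row can only reduce the count of k + 1, and the count of k that remains still
dominates the one of k + 1 before removal. -/
theorem SSYT.IsLR.restrict_of_hasLastRow {S D : Diagram} {L a : ℤ} {l : ℕ}
    (hS : HasLastRow S L a l) (hDS : D ⊆ S) (hD : ∀ p ∈ S, p.1 < L → p ∈ D) {T : SSYT S}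
    (hT : T.IsLR) : (T.restrict hDS).IsLR := fun c k =>
  (SSYT.cnt_restrict_le c (k + 1)).trans (hT.cnt_succ_le_cnt_restrict hS hDS hD c k)

/-- The first part of the content of a lattice tableau is at least the length of the last row. -/
theorem SSYT.IsLR.le_wt_zero {D : Diagram} {L a : ℤ} {l : ℕ} (hD : HasLastRow D L a l)
    {T : SSYT D} (hT : T.IsLR) : l ≤ T.wt 0 := by
  have hb : ∀ p ∈ D, T.val p < D.card := fun p hp => hT.val_lt_card hp
  have hsub : D.filter (fun p => p.1 < L) ⊆ D := Finset.filter_subset _ _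
  have h1 := Finset.sum_range_succ' T.wt D.card
  rw [Finset.sum_range_succ, T.sum_wt hb, T.wt_eq_zero hb le_rfl, add_zero] at h1
  -- The nonzero entries are no more than the boxes above the last row, so at least as many zeros
  -- remain as the last row has boxes.
  have h2 : ∑ k ∈ Finset.range D.card, T.wt (k + 1) ≤ (D.filter (fun p => p.1 < L)).card := by
    rw [← (T.restrict hsub).sum_wt (n := D.card)
      (fun p hp => by rw [SSYT.val_restrict hp]; exact hb p (hsub hp))]
    exact Finset.sum_le_sum fun k _ => hT.wt_succ_le_wt_restrict hD hsub
      (fun p hp h => Finset.mem_filter.2 ⟨hp, h⟩) k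
  have h3 : l ≤ (D.filter (fun p => ¬ p.1 < L)).card := by
    have : ((Finset.range l).image (fun j : ℕ => (L, a + (j : ℤ)))) ⊆
        D.filter (fun p => ¬ p.1 < L) := by
      intro p hp
      simp only [Finset.mem_image, Finset.mem_range] at hp
      obtain ⟨j, hj, rfl⟩ := hp
      exact Finset.mem_filter.2 ⟨(hD.mem_iff _).2 ⟨by omega, by omega⟩, by simp⟩
    have := Finset.card_le_card this
    rwa [Finset.card_image_of_injective _ (fun i j h => by simpa using h), Finset.card_range] at this
  have h4 := Finset.card_filter_add_card_filter_not (s := D) (fun p => p.1 < L)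
  omega

/-- The boxes of a row below `D`. -/
def rowBox (L a : ℤ) (j : ℕ) : ℤ × ℤ := (L + 1, a - 1 + j)

/-- The boxes of a column below and to the left of `D`. -/
def colBox (L a : ℤ) (j : ℕ) : ℤ × ℤ := (L + 1 + j, a - 1)

theorem rowBox_injective (L a : ℤ) : Function.Injective (rowBox L a) := fun i j h => by
  simpa [rowBox] using h

theorem colBox_injective (L a : ℤ) : Function.Injective (colBox L a) := fun i j h => by
  simpa [colBox] using h

theorem HasLastRow.rowBox_notMem {D : Diagram} {L a : ℤ} {l : ℕ} (hD : HasLastRow D L a l) (j : ℕ) :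
    rowBox L a j ∉ D := fun h => by
  have := hD.row_le _ h
  simp only [rowBox] at this
  omega

theorem HasLastRow.colBox_notMem {D : Diagram} {L a : ℤ} {l : ℕ} (hD : HasLastRow D L a l) (j : ℕ) :
    colBox L a j ∉ D := fun h => by
  have := hD.row_le _ h
  simp only [colBox] at this
  omega

theorem HasLastRow.attach_rowBox {D : Diagram} {L a : ℤ} {l : ℕ} (hD : HasLastRow D L a l) {m : ℕ}
    (hm : m ≤ l + 1) : HasLastRow (attach D (rowBox L a) m) (L + 1) (a - 1) m where
  ordConnected := by
    refine ⟨?_⟩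
    rintro ⟨r, x⟩ hp ⟨s, y⟩ hq ⟨t, z⟩ ⟨h1, h2⟩
    rw [Prod.mk_le_mk] at h1 h2
    rw [Finset.mem_coe, mem_attach] at hp hq ⊢
    rcases hp with hp | ⟨i, hi, hp⟩ <;> rcases hq with hq | ⟨j, hj, hq⟩
    · exact Or.inl (mem_of_ordConnected hD.ordConnected hp hq h1.1 h2.1 h1.2 h2.2)
    · simp only [rowBox, Prod.mk.injEq] at hq
      have ha := hD.le_col _ hp
      simp only at ha
      by_cases ht : t = L + 1
      · refine Or.inr ⟨(z - (a - 1)).toNat, by omega, ?_⟩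
        simp only [rowBox, Prod.mk.injEq]
        omega
      · have hz : (L, z) ∈ D := (hD.mem_iff z).2 ⟨by omega, by omega⟩
        exact Or.inl (mem_of_ordConnected hD.ordConnected hp hz h1.1 (by omega) h1.2 le_rfl)
    · simp only [rowBox, Prod.mk.injEq] at hp
      have := hD.row_le _ hq
      simp only at this
      omega
    · simp only [rowBox, Prod.mk.injEq] at hp hq
      refine Or.inr ⟨(z - (a - 1)).toNat, by omega, ?_⟩
      simp only [rowBox, Prod.mk.injEq]
      omega
  row_le := by
    intro p hp
    rcases mem_attach.1 hp with hp | ⟨j, hj, rfl⟩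
    · have := hD.row_le _ hp; omega
    · simp [rowBox]
  le_col := by
    intro p hp
    rcases mem_attach.1 hp with hp | ⟨j, hj, rfl⟩
    · have := hD.le_col _ hp; omega
    · simp [rowBox]
  mem_iff := by
    intro x
    rw [mem_attach]
    constructor
    · rintro (hp | ⟨j, hj, h⟩)
      · have := hD.row_le _ hp
        simp only at this
        omega
      · have := congrArg Prod.snd h
        simp only [rowBox] at this
        omega
    · intro h
      exact Or.inr ⟨(x - (a - 1)).toNat, by omega,
        Prod.ext (by simp [rowBox]) (by simp only [rowBox]; omega)⟩

theorem HasLastRow.ordConnected_attach_colBox {D : Diagram} {L a : ℤ} {l : ℕ}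
    (hD : HasLastRow D L a l) (m : ℕ) :
    (attach D (colBox L a) m : Set (ℤ × ℤ)).OrdConnected := by
  refine ⟨?_⟩
  rintro ⟨r, x⟩ hp ⟨s, y⟩ hq ⟨t, z⟩ ⟨h1, h2⟩
  rw [Prod.mk_le_mk] at h1 h2
  rw [Finset.mem_coe, mem_attach] at hp hq ⊢
  rcases hp with hp | ⟨i, hi, hp⟩ <;> rcases hq with hq | ⟨j, hj, hq⟩
  · exact Or.inl (mem_of_ordConnected hD.ordConnected hp hq h1.1 h2.1 h1.2 h2.2)
  · simp only [colBox, Prod.mk.injEq] at hq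
    have := hD.le_col _ hp
    simp only at this
    omega
  · simp only [colBox, Prod.mk.injEq] at hp
    have := hD.row_le _ hq
    simp only at this
    omega
  · simp only [colBox, Prod.mk.injEq] at hp hq
    refine Or.inr ⟨(t - (L + 1)).toNat, by omega, ?_⟩
    simp only [colBox, Prod.mk.injEq]
    omega

/-! ### Lattice tableaux of diagrams with a row or a column below -/

theorem val_rowBox_mono {D : Diagram} {L a : ℤ} {m : ℕ} (T : SSYT (attach D (rowBox L a) m))
    (i j : ℕ) (hij : i ≤ j) (hj : j < m) : T.val (rowBox L a i) ≤ T.val (rowBox L a j) :=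
  T.val_row (mem_attach_right D (rowBox L a) (hij.trans_lt hj))
    (mem_attach_right D (rowBox L a) hj) (by omega)

theorem val_colBox_strictMono {D : Diagram} {L a : ℤ} {m : ℕ} (T : SSYT (attach D (colBox L a) m))
    (i j : ℕ) (hij : i < j) (hj : j < m) : T.val (colBox L a i) < T.val (colBox L a j) :=
  T.val_col (mem_attach_right D (colBox L a) (hij.trans hj))
    (mem_attach_right D (colBox L a) hj) (by omega)

-- Restriction to D is injective because the row is weakly increasing and its multiset of entries is
-- the difference of the contents. The lattice condition bounds μ_{k+1} by ν_k, and `hfat` turns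
-- this into the vertical strip condition for the rows after the first.
open Classical in
theorem lrNum_attach_rowBox_le {D : Diagram} {L a : ℤ} {l : ℕ} (hD : HasLastRow D L a l) {m : ℕ}
    (hm : m ≤ l + 1) (hfat : ∀ T : SSYT D, T.IsLR → ∀ k, T.wt k ≤ T.wt (k + 1) + 1)
    (μ : YoungDiagram) :
    lrNum (attach D (rowBox L a) m) μ ≤ ∑ ν ∈ partitionsOf D.card,
      if IsDoubleStrip μ.rowLen ν.rowLen then lrNum D ν else 0 := by
  rw [← card_LRTabWith D (fun f => IsDoubleStrip μ.rowLen f), lrNum]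
  have hS := hD.attach_rowBox hm
  have hinj := rowBox_injective L a
  have hsub := subset_attach D (rowBox L a) m
  have hrest : ∀ p ∈ attach D (rowBox L a) m, p.1 < L + 1 → p ∈ D := by
    intro p hp hlt
    rcases mem_attach.1 hp with hp | ⟨j, hj, rfl⟩
    · exact hp
    · simp [rowBox] at hlt
  have hres : ∀ T : SSYT (attach D (rowBox L a) m), T.IsLR → (∀ k, T.wt k = μ.rowLen k) →
      IsDoubleStrip μ.rowLen (T.restrict hsub).wt := by
    intro T hT hwt
    have hstrip := hT.wt_succ_le_wt_restrict hS hsub hrest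
    have hfat' := hfat _ (hT.restrict_of_hasLastRow hS hsub hrest)
    have hsplit := wt_attach hinj hD.rowBox_notMem T
    refine ⟨fun k => ⟨?_, ?_⟩, fun k => ?_⟩
    · rw [← hwt, hsplit]; omega
    · rcases k with _ | k
      · rw [← hwt, hsplit]
        -- Row 0 of the strip needs a separate argument: since m ≤ l + 1, every box of the new row
        -- except the leftmost has a box of D above it, and so cannot contain 0.
        have hsub0 : (Finset.range m).filter (fun j => T.val (rowBox L a j) = 0) ⊆ {0} := by
          intro j hj
          obtain ⟨hj, h0⟩ := Finset.mem_filter.1 hj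
          rw [Finset.mem_range] at hj
          rw [Finset.mem_singleton]
          by_contra hne
          have hup : (L, a - 1 + (j : ℤ)) ∈ D := (hD.mem_iff _).2 ⟨by omega, by omega⟩
          have := T.val_col (hsub hup) (mem_attach_right D (rowBox L a) hj) (by omega)
          rw [rowBox] at h0
          omega
        have := Finset.card_le_card hsub0
        rw [Finset.card_singleton] at this
        omega
      · rw [← hwt]
        exact (hstrip k).trans (hfat' k)
    · rw [← hwt]
      exact hstrip k
  refine Nat.card_le_card_of_injective (fun T => ⟨T.1.restrict hsub,
    T.2.1.restrict_of_hasLastRow hS hsub hrest, hres T.1 T.2.1 T.2.2⟩) ?_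
  intro T T' h
  apply Subtype.ext
  exact eq_of_restrict_eq hinj hD.rowBox_notMem (val_rowBox_mono T.1) (val_rowBox_mono T'.1)
    (fun k => by rw [T.2.2, T'.2.2]) (congrArg Subtype.val h)

open Classical in
/-- The Pieri rule for a column placed below and to the left of a diagram. -/
theorem lrNum_attach_colBox {D : Diagram} {L a : ℤ} {l : ℕ} (hD : HasLastRow D L a l) {m : ℕ}
    {μ : YoungDiagram} (hμ : μ.card = D.card + m) :
    lrNum (attach D (colBox L a) m) μ = ∑ ν ∈ partitionsOf D.card,
      if IsVerticalStrip μ.rowLen ν.rowLen then lrNum D ν else 0 := by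
  rw [← card_LRTabWith D (fun f => IsVerticalStrip μ.rowLen f), lrNum]
  have hinj := colBox_injective L a
  have hsub := subset_attach D (colBox L a) m
  have hcnt : ∀ (T : SSYT (attach D (colBox L a) m)) (c : ℤ) (k : ℕ), a ≤ c →
      T.cnt c k = (T.restrict hsub).cnt c k := by
    intro T c k hc
    rw [cnt_attach hinj hD.colBox_notMem, Finset.filter_false_of_mem, Finset.card_empty, add_zero]
    intro j _ h
    simp only [colBox] at h
    omega
  have hlow : ∀ (T : SSYT D) (c : ℤ) (k : ℕ), c ≤ a → T.cnt c k = T.cnt a k := by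
    intro T c k hc
    rw [T.cnt_eq_wt hD.le_col, T.cnt_eq_wt fun p hp => hc.trans (hD.le_col p hp)]
  have hLR : ∀ T : SSYT (attach D (colBox L a) m), T.IsLR → (T.restrict hsub).IsLR := by
    intro T hT c k
    rcases le_total a c with hc | hc
    · rw [← hcnt T c _ hc, ← hcnt T c _ hc]; exact hT c k
    · rw [hlow _ c _ hc, hlow _ c _ hc, ← hcnt T a _ le_rfl, ← hcnt T a _ le_rfl]; exact hT a k
  have hV : ∀ T : SSYT (attach D (colBox L a) m), (∀ k, T.wt k = μ.rowLen k) →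
      IsVerticalStrip μ.rowLen (T.restrict hsub).wt := by
    intro T hwt k
    rw [← hwt, wt_attach hinj hD.colBox_notMem]
    have : ((Finset.range m).filter (fun j => T.val (colBox L a j) = k)).card ≤ 1 := by
      rw [Finset.card_le_one]
      intro i hi j hj
      simp only [Finset.mem_filter, Finset.mem_range] at hi hj
      rcases lt_trichotomy i j with hlt | heq | hgt
      · have := val_colBox_strictMono T i j hlt hj.1; omega
      · exact heq
      · have := val_colBox_strictMono T j i hgt hi.1; omega
    omega
  refine Nat.card_eq_of_bijective (fun T => ⟨T.1.restrict hsub, hLR T.1 T.2.1, hV T.1 T.2.2⟩)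
    ⟨?_, ?_⟩
  · intro T T' h
    apply Subtype.ext
    refine eq_of_restrict_eq hinj hD.colBox_notMem ?_ ?_
      (fun k => by rw [T.2.2, T'.2.2]) (congrArg Subtype.val h)
    · intro i j hij hj
      rcases hij.eq_or_lt with rfl | hij
      · exact le_rfl
      · exact (val_colBox_strictMono T.1 i j hij hj).le
    · intro i j hij hj
      rcases hij.eq_or_lt with rfl | hij
      · exact le_rfl
      · exact (val_colBox_strictMono T'.1 i j hij hj).le
  · rintro ⟨T', hT', hV'⟩
    obtain ⟨ν, hν, hwt⟩ := hT'.exists_shape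
    rw [funext hwt] at hV'
    obtain ⟨e, he, hek⟩ := exists_enum_verticalStrip hV' (m := m)
      (by rw [hμ, mem_partitionsOf.1 hν])
    -- Surjectivity: write the row indices of the strip down the column in increasing order.
    let f : ℤ × ℤ → ℕ := fun p => if p ∈ D then T'.val p else e (p.1 - (L + 1)).toNat
    have hf1 : ∀ p ∈ D, f p = T'.val p := fun p hp => if_pos hp
    have hf2 : ∀ j, f (colBox L a j) = e j := fun j => by
      rw [show f (colBox L a j) = _ from if_neg (hD.colBox_notMem j)]
      simp [colBox]
    let T : SSYT (attach D (colBox L a) m) := SSYT.ofFun f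
      (by
        intro r x y hx hy hxy
        rcases mem_attach.1 hx with hx | ⟨i, hi, hx⟩ <;> rcases mem_attach.1 hy with hy | ⟨j, hj, hy⟩
        · rw [hf1 _ hx, hf1 _ hy]; exact T'.val_row hx hy hxy.le
        · have := hD.row_le _ hx
          simp only [colBox, Prod.mk.injEq] at hy this
          omega
        · have := hD.row_le _ hy
          simp only [colBox, Prod.mk.injEq] at hx this
          omega
        · simp only [colBox, Prod.mk.injEq] at hx hy
          omega)
      (by
        intro r s x hr hs hrs
        rcases mem_attach.1 hr with hr | ⟨i, hi, hr⟩ <;> rcases mem_attach.1 hs with hs | ⟨j, hj, hs⟩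
        · rw [hf1 _ hr, hf1 _ hs]; exact T'.val_col hr hs hrs
        · have := hD.le_col _ hr
          simp only [colBox, Prod.mk.injEq] at hs this
          omega
        · have := hD.le_col _ hs
          simp only [colBox, Prod.mk.injEq] at hr this
          omega
        · rw [← hr, ← hs, hf2, hf2]
          apply he _ _ _ hj
          simp only [colBox, Prod.mk.injEq] at hr hs
          omega)
    have hTres : T.restrict hsub = T' := by
      apply SSYT.ext_val
      intro p hp
      rw [SSYT.val_restrict hp, SSYT.val_ofFun (hsub hp), hf1 p hp]
    have hTwt : ∀ k, T.wt k = μ.rowLen k := by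
      intro k
      rw [wt_attach hinj hD.colBox_notMem, hTres, hwt, ← hek k]
      congr 2
      refine Finset.filter_congr fun j hj => ?_
      rw [SSYT.val_ofFun (mem_attach_right _ _ (Finset.mem_range.1 hj)), hf2]
    have hTLR : T.IsLR := by
      intro c k
      rcases le_or_gt a c with hc | hc
      · rw [hcnt T c _ hc, hcnt T c _ hc, hTres]; exact hT' c k
      -- Once the new column is included, the whole tableau is, and its content is the partition μ.
      · have hall : ∀ p ∈ attach D (colBox L a) m, c ≤ p.2 := by
          intro p hp
          rcases mem_attach.1 hp with hp | ⟨j, hj, rfl⟩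
          · have := hD.le_col _ hp; omega
          · simp only [colBox]; omega
        rw [T.cnt_eq_wt hall, T.cnt_eq_wt hall, hTwt, hTwt]
        exact μ.rowLen_anti _ _ (Nat.le_succ k)
    exact ⟨⟨T, hTLR, hTwt⟩, Subtype.ext hTres⟩

/-! ### Rotated partitions -/

theorem mem_rotate {D : Diagram} {p : ℤ × ℤ} : p ∈ rotate D ↔ (-p.1, -p.2) ∈ D := by
  simp only [rotate, Finset.mem_image]
  constructor
  · rintro ⟨q, hq, rfl⟩; simpa using hq
  · intro h; exact ⟨_, h, by simp⟩

theorem card_rotate (D : Diagram) : (rotate D).card = D.card :=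
  Finset.card_image_of_injective _ fun p q h => by
    simp only [Prod.mk.injEq, neg_inj] at h
    exact Prod.ext h.1 h.2

theorem ordConnected_rotate {D : Diagram} (hD : (D : Set (ℤ × ℤ)).OrdConnected) :
    (rotate D : Set (ℤ × ℤ)).OrdConnected := by
  refine ⟨?_⟩
  rintro ⟨r, x⟩ hp ⟨s, y⟩ hq ⟨t, z⟩ ⟨h1, h2⟩
  rw [Prod.mk_le_mk] at h1 h2
  rw [Finset.mem_coe, mem_rotate] at hp hq ⊢
  exact mem_of_ordConnected hD hq hp (by omega) (by omega) (by omega) (by omega)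

theorem mem_rotate_ferrers {ν : YoungDiagram} {i j : ℕ} :
    (-(i : ℤ), -(j : ℤ)) ∈ rotate (ferrers ν) ↔ (i, j) ∈ ν := by
  rw [mem_rotate]
  simp only [neg_neg]
  exact mem_ferrers

theorem exists_of_mem_rotate_ferrers {ν : YoungDiagram} {p : ℤ × ℤ}
    (h : p ∈ rotate (ferrers ν)) : ∃ i j : ℕ, p = (-↑i, -↑j) ∧ (i, j) ∈ ν := by
  rw [mem_rotate] at h
  obtain ⟨i, j, h, hij⟩ := exists_of_mem_ferrers h
  simp only [Prod.mk.injEq] at h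
  exact ⟨i, j, Prod.ext (by simp only; omega) (by simp only; omega), hij⟩

theorem hasLastRow_rotate_ferrers (ν : YoungDiagram) :
    HasLastRow (rotate (ferrers ν)) 0 (1 - ν.rowLen 0) (ν.rowLen 0) where
  ordConnected := ordConnected_rotate (ordConnected_ferrers ν)
  row_le := by
    intro p hp
    obtain ⟨i, j, rfl, -⟩ := exists_of_mem_rotate_ferrers hp
    simp
  le_col := by
    intro p hp
    obtain ⟨i, j, rfl, hij⟩ := exists_of_mem_rotate_ferrers hp
    have := YoungDiagram.mem_iff_lt_rowLen.1 (ν.up_left_mem (Nat.zero_le i) le_rfl hij)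
    simp only
    omega
  mem_iff := by
    intro x
    constructor
    · intro h
      obtain ⟨i, j, h, hij⟩ := exists_of_mem_rotate_ferrers h
      have := YoungDiagram.mem_iff_lt_rowLen.1 (ν.up_left_mem (Nat.zero_le i) le_rfl hij)
      simp only [Prod.mk.injEq] at h
      omega
    · intro h
      have hx : ((0 : ℤ), x) = (-((0 : ℕ) : ℤ), -((-x).toNat : ℤ)) :=
        Prod.ext (by simp) (by simp only; omega)
      rw [hx, mem_rotate_ferrers, YoungDiagram.mem_iff_lt_rowLen]
      omega

/-- The tableau of rotated straight shape whose columns have the entries `0, 1, 2, …`. -/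
def rotTableau (ν : YoungDiagram) : SSYT (rotate (ferrers ν)) :=
  SSYT.ofFun (fun p => ν.colLen (-p.2).toNat - 1 - (-p.1).toNat)
    (by
      intro r x y hx hy h
      have := ν.colLen_anti (-y).toNat (-x).toNat (by omega)
      simp only
      omega)
    (by
      intro r s x hr hs h
      obtain ⟨i, j, hr, hij⟩ := exists_of_mem_rotate_ferrers hr
      obtain ⟨i', j', hs, hij'⟩ := exists_of_mem_rotate_ferrers hs
      rw [YoungDiagram.mem_iff_lt_colLen] at hij hij'
      simp only [Prod.mk.injEq] at hr hs
      obtain ⟨rfl, rfl⟩ := hr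
      obtain ⟨rfl, hjj⟩ := hs
      obtain rfl : j = j' := by omega
      simp only [neg_neg, Int.toNat_natCast]
      omega)

theorem rotTableau_val {ν : YoungDiagram} {i j : ℕ} (h : (i, j) ∈ ν) :
    (rotTableau ν).val (-↑i, -↑j) = ν.colLen j - 1 - i := by
  rw [rotTableau, SSYT.val_ofFun (mem_rotate_ferrers.2 h)]
  simp

/-- Entry k occurs once in each column of length greater than k. These are the rightmost `ν.rowLen
k` columns, of which at most 1 - c lie from column c on. -/
theorem cnt_rotTableau (ν : YoungDiagram) (c : ℤ) (k : ℕ) :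
    (rotTableau ν).cnt c k = min (ν.rowLen k) (1 - c).toNat := by
  rw [SSYT.cnt, ← Finset.card_range (min (ν.rowLen k) (1 - c).toNat)]
  symm
  have hk : ∀ {j}, j < ν.rowLen k → k < ν.colLen j := fun {j} hj => by
    rwa [← YoungDiagram.mem_iff_lt_colLen, YoungDiagram.mem_iff_lt_rowLen]
  refine Finset.card_bij (fun j _ => (-((ν.colLen j - 1 - k : ℕ) : ℤ), -(j : ℤ))) ?_ ?_ ?_
  · intro j hj
    rw [Finset.mem_range, lt_min_iff] at hj
    have h1 := hk hj.1
    have hm : (ν.colLen j - 1 - k, j) ∈ ν := YoungDiagram.mem_iff_lt_colLen.2 (by omega)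
    refine Finset.mem_filter.2 ⟨mem_rotate_ferrers.2 hm, by simp only; omega, ?_⟩
    rw [rotTableau_val hm]
    omega
  · intro i _ j _ h
    simpa using congrArg Prod.snd h
  · intro p hp
    obtain ⟨hp, hc, hpk⟩ := Finset.mem_filter.1 hp
    obtain ⟨i, j, rfl, hij⟩ := exists_of_mem_rotate_ferrers hp
    rw [rotTableau_val hij] at hpk
    rw [YoungDiagram.mem_iff_lt_colLen] at hij
    refine ⟨j, ?_, Prod.ext (by simp only; omega) rfl⟩
    rw [Finset.mem_range, lt_min_iff, ← YoungDiagram.mem_iff_lt_rowLen,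
      YoungDiagram.mem_iff_lt_colLen]
    simp only at hc
    omega

theorem isLR_rotTableau (ν : YoungDiagram) : (rotTableau ν).IsLR := by
  intro c k
  rw [cnt_rotTableau, cnt_rotTableau]
  have := ν.rowLen_anti k (k + 1) (Nat.le_succ k)
  omega

theorem wt_rotTableau (ν : YoungDiagram) (k : ℕ) : (rotTableau ν).wt k = ν.rowLen k := by
  rw [← SSYT.cnt_eq_wt _ (hasLastRow_rotate_ferrers ν).le_col, cnt_rotTableau]
  have := ν.rowLen_anti 0 k (Nat.zero_le k)
  omega

/-- Induction over the columns from right to left, and downwards in each. If an entry k + 1 is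
larger than its depth u, the columns to the right all contain k + 1, and column j itself has no k.
Then each k is paired with the k + 1 below it, and one k + 1 is left over, against the lattice
condition. -/
theorem SSYT.IsLR.val_rotate_ferrers {ν : YoungDiagram} {T : SSYT (rotate (ferrers ν))}
    (h : T.IsLR) (j : ℕ) : ∀ u i : ℕ, u + i + 1 = ν.colLen j → T.val (-↑i, -↑j) = u := by
  induction j using Nat.strong_induction_on with
  | _ j ihj =>
  intro u
  induction u using Nat.strong_induction_on with
  | _ u ihu =>
  intro i hi
  have hij : (i, j) ∈ ν := YoungDiagram.mem_iff_lt_colLen.2 (by omega)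
  have hge : u ≤ T.val (-↑i, -↑j) := by
    rcases Nat.eq_zero_or_pos u with h0 | h0
    · omega
    · have hm : (i + 1, j) ∈ ν := YoungDiagram.mem_iff_lt_colLen.2 (by omega)
      have h1 := T.val_col (mem_rotate_ferrers.2 hm) (mem_rotate_ferrers.2 hij) (by omega)
      rw [ihu (u - 1) (by omega) (i + 1) (by omega)] at h1
      omega
  by_contra hne
  obtain ⟨k, hk⟩ : ∃ k, T.val (-↑i, -↑j) = k + 1 := ⟨T.val (-↑i, -↑j) - 1, by omega⟩
  -- Compare k + 1 with the bottom entry of its own column, then along the bottom row with that of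
  -- column j', which is known to be one less than the column length.
  have hlong : ∀ j' < j, k + 2 ≤ ν.colLen j' := by
    intro j' hj'
    have h0 : (0, j) ∈ ν := ν.up_left_mem (Nat.zero_le i) le_rfl hij
    have h0' : (0, j') ∈ ν := ν.up_left_mem le_rfl hj'.le h0
    have h1 : T.val (-↑i, -↑j) ≤ T.val (-((0 : ℕ) : ℤ), -↑j) := by
      rcases Nat.eq_zero_or_pos i with rfl | hi0
      · exact le_rfl
      · exact (T.val_col (mem_rotate_ferrers.2 hij) (mem_rotate_ferrers.2 h0) (by omega)).le
    have h2 := T.val_row (mem_rotate_ferrers.2 h0) (mem_rotate_ferrers.2 h0') (by omega)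
    have h3 := YoungDiagram.mem_iff_lt_colLen.1 h0'
    rw [ihj j' hj' (ν.colLen j' - 1) 0 (by omega)] at h2
    omega
  have hsub : ((rotate (ferrers ν)).filter (fun p => -(j : ℤ) ≤ p.2 ∧ T.val p = k)).image
      (fun p => (p.1 + 1, p.2)) ⊆
      ((rotate (ferrers ν)).filter (fun p => -(j : ℤ) ≤ p.2 ∧ T.val p = k + 1)).erase
        (-↑i, -↑j) := by
    intro p hp
    obtain ⟨q, hq, rfl⟩ := Finset.mem_image.1 hp
    obtain ⟨hq, hqj, hqk⟩ := Finset.mem_filter.1 hq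
    obtain ⟨a, b, rfl, hab⟩ := exists_of_mem_rotate_ferrers hq
    have hlen := YoungDiagram.mem_iff_lt_colLen.1 hab
    have hbj : b < j := by
      simp only at hqj
      refine lt_of_le_of_ne (by omega) ?_
      rintro rfl
      rcases lt_trichotomy a i with h1 | h1 | h1
      · have := T.val_col (mem_rotate_ferrers.2 hij) (mem_rotate_ferrers.2 hab) (by omega)
        omega
      · subst h1; omega
      · rw [ihu (ν.colLen b - 1 - a) (by omega) a (by omega)] at hqk
        omega
    rw [ihj b hbj (ν.colLen b - 1 - a) a (by omega)] at hqk
    have hl := hlong b hbj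
    have hup : (a - 1, b) ∈ ν := ν.up_left_mem (Nat.sub_le a 1) le_rfl hab
    have heq : ((-(a : ℤ) + 1, -(b : ℤ)) : ℤ × ℤ) = (-((a - 1 : ℕ) : ℤ), -(b : ℤ)) :=
      Prod.ext (by simp only; omega) rfl
    simp only
    rw [heq]
    refine Finset.mem_erase.2 ⟨?_, Finset.mem_filter.2 ⟨mem_rotate_ferrers.2 hup, hqj, ?_⟩⟩
    · intro he
      have := congrArg Prod.snd he
      simp only at this
      omega
    · rw [ihj b hbj (ν.colLen b - 1 - (a - 1)) (a - 1) (by omega)]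
      omega
  have h1 := Finset.card_le_card hsub
  rw [Finset.card_image_of_injective _ (fun p q h => by
    simp only [Prod.mk.injEq, add_left_inj] at h; exact Prod.ext h.1 h.2),
    Finset.card_erase_of_mem (Finset.mem_filter.2 ⟨mem_rotate_ferrers.2 hij, by simp, hk⟩)] at h1
  have h2 := h (-↑j) k
  have h3 : 0 < T.cnt (-↑j) (k + 1) :=
    Finset.card_pos.2 ⟨(-↑i, -↑j), Finset.mem_filter.2 ⟨mem_rotate_ferrers.2 hij, by simp, hk⟩⟩
  rw [SSYT.cnt] at h2 h3
  rw [SSYT.cnt] at h2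
  omega

theorem SSYT.IsLR.eq_rotTableau {ν : YoungDiagram} {T : SSYT (rotate (ferrers ν))} (h : T.IsLR) :
    T = rotTableau ν := by
  apply SSYT.ext_val
  intro p hp
  obtain ⟨i, j, rfl, hij⟩ := exists_of_mem_rotate_ferrers hp
  have := YoungDiagram.mem_iff_lt_colLen.1 hij
  rw [rotTableau_val hij, h.val_rotate_ferrers j (ν.colLen j - 1 - i) i (by omega)]

open Classical in
theorem lrNum_rotate_ferrers (ν ν' : YoungDiagram) :
    lrNum (rotate (ferrers ν)) ν' = if ν' = ν then 1 else 0 := by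
  split_ifs with h
  · subst h
    rw [lrNum, Nat.card_eq_one_iff_unique]
    exact ⟨⟨fun T T' => Subtype.ext (T.2.1.eq_rotTableau.trans T'.2.1.eq_rotTableau.symm)⟩,
      ⟨⟨rotTableau ν', isLR_rotTableau ν', wt_rotTableau ν'⟩⟩⟩
  · rw [lrNum, Nat.card_eq_zero]
    left
    refine ⟨fun T => h ?_⟩
    apply youngDiagram_ext_rowLen
    intro k
    rw [← T.2.2, T.2.1.eq_rotTableau, wt_rotTableau]

open Classical in
theorem sum_lrNum_rotate_ferrers (ν : YoungDiagram) (Q : YoungDiagram → Prop) :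
    (∑ ν' ∈ partitionsOf (rotate (ferrers ν)).card,
      if Q ν' then lrNum (rotate (ferrers ν)) ν' else 0) = if Q ν then 1 else 0 := by
  rw [Finset.sum_eq_single_of_mem ν (mem_partitionsOf.2 (by rw [card_rotate, card_ferrers]))]
  · rw [lrNum_rotate_ferrers, if_pos rfl]
  · intro ν' _ hne
    rw [lrNum_rotate_ferrers, if_neg hne, ite_self]

/-- Every double strip over `ν` is the content of a lattice tableau on the rotation of `ν` with a
row below. -/
theorem lrNum_attach_rowBox_pos {μ ν : YoungDiagram} {m : ℕ} (hm : m ≤ ν.rowLen 0 + 1)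
    (hμ : μ.card = ν.card + m) (h : IsDoubleStrip μ.rowLen ν.rowLen) :
    0 < lrNum (attach (rotate (ferrers ν)) (rowBox 0 (1 - ν.rowLen 0)) m) μ := by
  have hD := hasLastRow_rotate_ferrers ν
  have hinj := rowBox_injective 0 (1 - ν.rowLen 0)
  have hsub := subset_attach (rotate (ferrers ν)) (rowBox 0 (1 - ν.rowLen 0)) m
  obtain ⟨e, he, hek⟩ := exists_enum_verticalStrip h.1 hμ
  -- The rows of ν at successive strip boxes strictly shorten, because two boxes of a double strip
  -- never share a column. This one inequality gives both the column and the lattice condition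
  -- below.
  have hlen : ∀ j < m, ν.rowLen (e j) + j ≤ ν.rowLen 0 := by
    intro j
    induction j with
    | zero => intro _; exact ν.rowLen_anti 0 (e 0) (Nat.zero_le _)
    | succ j ih =>
      intro hj
      have h1 := ih (by omega)
      have h2 := he j (j + 1) (by omega) hj
      have h3 : 0 < ((Finset.range m).filter (fun i => e i = e (j + 1))).card :=
        Finset.card_pos.2 ⟨j + 1, Finset.mem_filter.2 ⟨Finset.mem_range.2 hj, rfl⟩⟩
      have h4 := hek (e (j + 1))
      have h5 := h.2 (e (j + 1) - 1)
      rw [Nat.sub_add_cancel (by omega)] at h5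
      have h6 := ν.rowLen_anti (e j) (e (j + 1) - 1) (by omega)
      omega
  let f : ℤ × ℤ → ℕ := fun p => if p ∈ rotate (ferrers ν) then (rotTableau ν).val p
    else e (p.2 - (1 - ν.rowLen 0 - 1)).toNat
  have hf1 : ∀ p ∈ rotate (ferrers ν), f p = (rotTableau ν).val p := fun p hp => if_pos hp
  have hf2 : ∀ j, f (rowBox 0 (1 - ν.rowLen 0) j) = e j := fun j => by
    rw [show f (rowBox 0 (1 - ν.rowLen 0) j) = _ from if_neg (hD.rowBox_notMem j)]
    simp [rowBox]
  let T : SSYT (attach (rotate (ferrers ν)) (rowBox 0 (1 - ν.rowLen 0)) m) := SSYT.ofFun f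
    (by
      intro r x y hx hy hxy
      rcases mem_attach.1 hx with hx | ⟨i, hi, hx⟩ <;> rcases mem_attach.1 hy with hy | ⟨j, hj, hy⟩
      · rw [hf1 _ hx, hf1 _ hy]; exact (rotTableau ν).val_row hx hy hxy.le
      · have := hD.row_le _ hx
        simp only [rowBox, Prod.mk.injEq] at hy this
        omega
      · have := hD.row_le _ hy
        simp only [rowBox, Prod.mk.injEq] at hx this
        omega
      · rw [← hx, ← hy, hf2, hf2]
        refine (he _ _ ?_ hj).le
        simp only [rowBox, Prod.mk.injEq] at hx hy
        omega)
    (by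
      intro r s x hr hs hrs
      rcases mem_attach.1 hr with hr | ⟨i, hi, hr⟩ <;> rcases mem_attach.1 hs with hs | ⟨j, hj, hs⟩
      · rw [hf1 _ hr, hf1 _ hs]; exact (rotTableau ν).val_col hr hs hrs
      · rw [hf1 _ hr, ← hs, hf2]
        obtain ⟨a, b, hab, hmem⟩ := exists_of_mem_rotate_ferrers hr
        rw [hab, rotTableau_val hmem]
        simp only [rowBox, Prod.mk.injEq] at hs hab
        have h1 := hlen j hj
        have h2 := YoungDiagram.mem_iff_lt_rowLen.1 (ν.up_left_mem (Nat.zero_le a) le_rfl hmem)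
        -- Box j of the row lies under column b = ν_0 - j ≥ ν_{e j}, whose length is therefore at
        -- most e j, so all entries above are smaller.
        have h3 : ¬ e j < ν.colLen b := by
          rw [← YoungDiagram.mem_iff_lt_colLen, YoungDiagram.mem_iff_lt_rowLen]
          omega
        have h4 := YoungDiagram.mem_iff_lt_colLen.1 hmem
        omega
      · have := hD.row_le _ hs
        simp only [rowBox, Prod.mk.injEq] at hr this
        omega
      · simp only [rowBox, Prod.mk.injEq] at hr hs
        omega)
  have hTrow : ∀ j < m, T.val (rowBox 0 (1 - ν.rowLen 0) j) = e j := fun j hj => by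
    rw [SSYT.val_ofFun (mem_attach_right _ _ hj), hf2]
  have hTres : T.restrict hsub = rotTableau ν := by
    apply SSYT.ext_val
    intro p hp
    rw [SSYT.val_restrict hp, SSYT.val_ofFun (hsub hp), hf1 p hp]
  have hTwt : ∀ k, T.wt k = μ.rowLen k := by
    intro k
    rw [wt_attach hinj hD.rowBox_notMem, hTres, wt_rotTableau, ← hek k]
    congr 2
    exact Finset.filter_congr fun j hj => by rw [hTrow j (Finset.mem_range.1 hj)]
  have hTLR : T.IsLR := by
    intro c k
    by_cases hc : c ≤ 1 - ν.rowLen 0 - 1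
    · have hall : ∀ p ∈ attach (rotate (ferrers ν)) (rowBox 0 (1 - ν.rowLen 0)) m, c ≤ p.2 := by
        intro p hp
        rcases mem_attach.1 hp with hp | ⟨j, hj, rfl⟩
        · have := hD.le_col _ hp; omega
        · simp only [rowBox]; omega
      rw [T.cnt_eq_wt hall, T.cnt_eq_wt hall, hTwt, hTwt]
      exact μ.rowLen_anti _ _ (Nat.le_succ k)
    · rw [cnt_attach hinj hD.rowBox_notMem, cnt_attach hinj hD.rowBox_notMem, hTres,
        cnt_rotTableau, cnt_rotTableau]
      have hanti := ν.rowLen_anti k (k + 1) (Nat.le_succ k)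
      by_cases hex : ((Finset.range m).filter (fun j => c ≤ (rowBox 0 (1 - ν.rowLen 0) j).2 ∧
          T.val (rowBox 0 (1 - ν.rowLen 0) j) = k + 1)).card = 0
      · rw [hex]
        omega
      -- The row adds at most one k + 1. If it lies from column c on, `hlen` gives ν_{k+1} + 1 ≤ 1 -
      -- c, while the double strip gives ν_{k+1} + 1 ≤ ν_k; so the minimum for k leaves room for it.
      · obtain ⟨j, hj⟩ := Finset.card_pos.1 (Nat.pos_of_ne_zero hex)
        obtain ⟨hjm, hjc, hjk⟩ := Finset.mem_filter.1 hj
        rw [Finset.mem_range] at hjm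
        rw [hTrow j hjm] at hjk
        simp only [rowBox] at hjc
        have hle : ((Finset.range m).filter (fun j => c ≤ (rowBox 0 (1 - ν.rowLen 0) j).2 ∧
            T.val (rowBox 0 (1 - ν.rowLen 0) j) = k + 1)).card ≤
            ((Finset.range m).filter (fun j => e j = k + 1)).card := by
          refine Finset.card_le_card fun i hi => ?_
          obtain ⟨him, -, hik⟩ := Finset.mem_filter.1 hi
          rw [hTrow i (Finset.mem_range.1 him)] at hik
          exact Finset.mem_filter.2 ⟨him, hik⟩
        have h1 := hek (k + 1)
        have h2 := (h.1 (k + 1)).2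
        have h3 := h.2 k
        have h4 := hlen j hjm
        rw [hjk] at h4
        have h5 : 0 < ((Finset.range m).filter (fun j => e j = k + 1)).card :=
          Finset.card_pos.2 ⟨j, Finset.mem_filter.2 ⟨Finset.mem_range.2 hjm, hjk⟩⟩
        omega
  have : Nonempty (LRTab (attach (rotate (ferrers ν)) (rowBox 0 (1 - ν.rowLen 0)) m) μ) :=
    ⟨⟨T, hTLR, hTwt⟩⟩
  exact Nat.card_pos

/-! ### Fat staircases -/

theorem mem_deltaRows {α : List ℕ} {v : ℕ} :
    v ∈ deltaRows α ↔ ∃ i < α.length, α.getD i 0 ≠ 0 ∧ v = i + 1 := by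
  simp only [deltaRows, List.mem_flatMap, List.mem_reverse, List.mem_range, List.mem_replicate]

/-- All values from 1 to the largest part occur. A drop by two or more would skip the value
`ν.rowLen (k + 1) + 1`, for which there is no row between k and k + 1. A zero row k + 1 is included:
the last part is 1. -/
theorem IsFatStaircase.rowLen_le {ν : YoungDiagram} (h : IsFatStaircase ν) (k : ℕ) :
    ν.rowLen k ≤ ν.rowLen (k + 1) + 1 := by
  obtain ⟨α, hα, rfl⟩ := h
  have hpos : ∀ x ∈ deltaRows α, 0 < x := fun x hx => by
    obtain ⟨i, -, -, rfl⟩ := mem_deltaRows.1 hx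
    omega
  have hrl : (delta α).rowLens = deltaRows α := YoungDiagram.rowLens_ofRowLens_eq_self hpos
  have hmem : ∀ v, v ∈ deltaRows α ↔ 0 < v ∧ ∃ i, (delta α).rowLen i = v := by
    intro v
    rw [← hrl, YoungDiagram.rowLens, List.mem_map]
    constructor
    · rintro ⟨i, hi, rfl⟩
      rw [List.mem_range, ← YoungDiagram.mem_iff_lt_colLen, YoungDiagram.mem_iff_lt_rowLen] at hi
      exact ⟨hi, i, rfl⟩
    · rintro ⟨hv, i, rfl⟩
      refine ⟨i, ?_, rfl⟩
      rwa [List.mem_range, ← YoungDiagram.mem_iff_lt_colLen, YoungDiagram.mem_iff_lt_rowLen]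
  by_contra hlt
  obtain ⟨i, hi, -, hik⟩ := mem_deltaRows.1 ((hmem _).2 ⟨by omega, k, rfl⟩)
  have hv : (delta α).rowLen (k + 1) + 1 ∈ deltaRows α := by
    refine mem_deltaRows.2 ⟨(delta α).rowLen (k + 1), by omega, ?_, rfl⟩
    rw [List.getD_eq_getElem _ _ (by omega)]
    exact (hα _ (List.getElem_mem _)).ne'
  obtain ⟨-, r, hr⟩ := (hmem _).1 hv
  rcases Nat.lt_or_ge k r with h1 | h1
  · have := (delta α).rowLen_anti (k + 1) r h1
    omega
  · have := (delta α).rowLen_anti r k h1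
    omega

theorem count_deltaRows (α : List ℕ) (i : ℕ) :
    (deltaRows α).count (i + 1) = α.getD i 0 := by
  rw [deltaRows, List.count_flatMap, List.map_reverse, List.sum_reverse]
  have : ∀ n, (List.map (List.count (i + 1) ∘ fun i => List.replicate (α.getD i 0) (i + 1))
      (List.range n)).sum = if i < n then α.getD i 0 else 0 := by
    intro n
    induction n with
    | zero => simp
    | succ n ih =>
      rw [List.range_succ, List.map_append, List.sum_append, ih]
      simp only [List.map_cons, List.map_nil, List.sum_cons, List.sum_nil, Function.comp,
        List.count_replicate, add_zero, beq_iff_eq, add_left_inj]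
      rcases lt_trichotomy i n with h | h | h
      · rw [if_pos h, if_neg (by omega), if_pos (by omega), add_zero]
      · subst h; simp
      · rw [if_neg (by omega), if_neg (by omega), if_neg (by omega)]
  rw [this]
  split_ifs with h
  · rfl
  · rw [List.getD_eq_default _ _ (not_lt.1 h)]

/-- Both row lists are sorted and have the same multiplicities. This needs no staircase hypothesis,
as zero multiplicities are harmless. -/
theorem delta_alpha (ν : YoungDiagram) : delta (alpha ν) = ν := by
  have hperm : (deltaRows (alpha ν)).Perm ν.rowLens := by
    rw [List.perm_iff_count]
    intro v
    rcases v with _ | i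
    · rw [List.count_eq_zero_of_not_mem, List.count_eq_zero_of_not_mem]
      · intro h; exact absurd (ν.pos_of_mem_rowLens 0 h) (lt_irrefl 0)
      · intro h
        obtain ⟨i, -, -, h⟩ := mem_deltaRows.1 h
        omega
    · rw [count_deltaRows]
      by_cases hi : i < ν.rowLen 0
      · rw [List.getD_eq_getElem _ _ (by simpa [alpha] using hi)]
        simp [alpha]
      · rw [List.getD_eq_default _ _ (by simpa [alpha] using hi), List.count_eq_zero_of_not_mem]
        intro h
        simp only [YoungDiagram.rowLens, List.mem_map] at h
        obtain ⟨r, -, h⟩ := h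
        have := ν.rowLen_anti 0 r (Nat.zero_le r)
        omega
  have heq : deltaRows (alpha ν) = ν.rowLens :=
    hperm.eq_of_pairwise (fun _ _ _ _ h1 h2 => le_antisymm h2 h1)
      (deltaRows_sorted _).pairwise ν.rowLens_sorted.pairwise
  have : delta (alpha ν) = YoungDiagram.ofRowLens ν.rowLens ν.rowLens_sorted := by
    simp only [delta, heq]
  rw [this, YoungDiagram.ofRowLens_to_rowLens_eq_self]

/-! ### The last row of a skew diagram -/

theorem ordConnected_skew (ρ κ : YoungDiagram) : (skew ρ κ : Set (ℤ × ℤ)).OrdConnected := by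
  refine ⟨?_⟩
  rintro ⟨r, x⟩ hp ⟨s, y⟩ hq ⟨t, z⟩ ⟨h1, h2⟩
  rw [Finset.mem_coe, skew, Finset.mem_sdiff] at hp hq ⊢
  refine ⟨Finset.mem_coe.1 ((ordConnected_ferrers ρ).out (Finset.mem_coe.2 hp.1)
    (Finset.mem_coe.2 hq.1) ⟨h1, h2⟩), fun h => hp.2 ?_⟩
  obtain ⟨i, j, h, hij⟩ := exists_of_mem_ferrers h
  obtain ⟨i', j', h', -⟩ := exists_of_mem_ferrers hp.1
  rw [Prod.mk_le_mk] at h1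
  simp only [Prod.mk.injEq] at h h'
  obtain ⟨rfl, rfl⟩ := h'
  exact mem_ferrers.2 (κ.up_left_mem (by omega) (by omega) hij)

theorem skew_nonempty {ρ κ : YoungDiagram} (h : κ < ρ) : (skew ρ κ).Nonempty := by
  obtain ⟨⟨i, j⟩, h1, h2⟩ := Finset.exists_of_ssubset (YoungDiagram.cells_ssubset_iff.2 h)
  exact ⟨(↑i, ↑j), Finset.mem_sdiff.2 ⟨mem_ferrers.2 h1, fun h3 => h2 (mem_ferrers.1 h3)⟩⟩

theorem exists_hasLastRow {D : Diagram} (hD : (D : Set (ℤ × ℤ)).OrdConnected) (hne : D.Nonempty) :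
    ∃ L a l, 0 < l ∧ HasLastRow D L a l := by
  obtain ⟨⟨L, x⟩, hx, hL⟩ := D.exists_max_image Prod.fst hne
  have hne' : (D.filter (fun p => p.1 = L)).Nonempty := ⟨_, Finset.mem_filter.2 ⟨hx, rfl⟩⟩
  obtain ⟨⟨L1, a⟩, ha, hamin⟩ := (D.filter (fun p => p.1 = L)).exists_min_image Prod.snd hne'
  obtain ⟨⟨L2, b⟩, hb, hbmax⟩ := (D.filter (fun p => p.1 = L)).exists_max_image Prod.snd hne'
  obtain ⟨ha', hL1⟩ := Finset.mem_filter.1 ha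
  obtain ⟨hb', hL2⟩ := Finset.mem_filter.1 hb
  simp only at hL1 hL2 hL
  subst hL1 hL2
  have hab : a ≤ b := hamin (L2, b) hb
  refine ⟨L2, a, (b - a + 1).toNat, by omega, hD, hL, ?_, ?_⟩
  · rintro ⟨r, y⟩ hp
    by_contra hlt
    simp only [not_le] at hlt
    have h1 := mem_of_ordConnected hD hp ha' (hL _ hp) le_rfl le_rfl hlt.le
    have := hamin _ (Finset.mem_filter.2 ⟨h1, rfl⟩)
    simp only at this
    omega
  · intro y
    constructor
    · intro hy
      have h1 := hamin _ (Finset.mem_filter.2 ⟨hy, rfl⟩)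
      have h2 := hbmax _ (Finset.mem_filter.2 ⟨hy, rfl⟩)
      simp only at h1 h2
      omega
    · rintro ⟨h1, h2⟩
      exact mem_of_ordConnected hD ha' hb' le_rfl le_rfl h1 (by omega)

theorem HasLastRow.lastRow_eq {D : Diagram} {L a : ℤ} {l : ℕ} (h : HasLastRow D L a l)
    (hl : 0 < l) : lastRow D = L := by
  have hmem : (L, a) ∈ D := (h.mem_iff a).2 ⟨le_rfl, by omega⟩
  have hne : (D.image Prod.fst).Nonempty := ⟨L, (Finset.mem_image_of_mem Prod.fst hmem : (L, a).1 ∈ _)⟩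
  rw [lastRow, ← Finset.coe_max' hne, WithBot.unbotD_coe]
  apply le_antisymm
  · refine Finset.max'_le _ _ _ fun r hr => ?_
    obtain ⟨p, hp, rfl⟩ := Finset.mem_image.1 hr
    exact h.row_le p hp
  · exact Finset.le_max' (D.image Prod.fst) L (Finset.mem_image.2 ⟨(L, a), hmem, rfl⟩)

theorem HasLastRow.lastRowStart_eq {D : Diagram} {L a : ℤ} {l : ℕ} (h : HasLastRow D L a l)
    (hl : 0 < l) : lastRowStart D = a := by
  have hmem : (L, a) ∈ D := (h.mem_iff a).2 ⟨le_rfl, by omega⟩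
  have hmem' : a ∈ (D.filter (fun p => p.1 = L)).image Prod.snd :=
    Finset.mem_image.2 ⟨(L, a), Finset.mem_filter.2 ⟨hmem, rfl⟩, rfl⟩
  rw [lastRowStart, h.lastRow_eq hl, ← Finset.coe_min' ⟨a, hmem'⟩, WithTop.untopD_coe]
  apply le_antisymm
  · exact Finset.min'_le _ _ hmem'
  · refine Finset.le_min' _ _ _ fun r hr => ?_
    obtain ⟨p, hp, rfl⟩ := Finset.mem_image.1 hr
    exact h.le_col p (Finset.mem_filter.1 hp).1

theorem HasLastRow.lastRowLength_eq {D : Diagram} {L a : ℤ} {l : ℕ} (h : HasLastRow D L a l)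
    (hl : 0 < l) : lastRowLength D = l := by
  rw [lastRowLength, h.lastRow_eq hl]
  have : D.filter (fun p => p.1 = L) = (Finset.range l).image (fun j : ℕ => (L, a + (j : ℤ))) := by
    ext ⟨r, x⟩
    simp only [Finset.mem_filter, Finset.mem_image, Finset.mem_range, Prod.mk.injEq]
    constructor
    · rintro ⟨h1, rfl⟩
      have := (h.mem_iff x).1 h1
      exact ⟨(x - a).toNat, by omega, rfl, by omega⟩
    · rintro ⟨j, hj, rfl, rfl⟩
      exact ⟨(h.mem_iff _).2 ⟨by omega, by omega⟩, rfl⟩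
  rw [this, Finset.card_image_of_injective _ (fun i j h => by simpa using h), Finset.card_range]

/-! ### One-row and one-column foundations as attached boxes -/

theorem ferrers_eq_of_one_row {lam : YoungDiagram} (h : lam.rowLens.length = 1) :
    ferrers lam = (Finset.range (lam.rowLen 0)).image (fun j : ℕ => ((0 : ℤ), (j : ℤ))) := by
  rw [YoungDiagram.length_rowLens] at h
  have hmem : ∀ i j, (i, j) ∈ lam ↔ i = 0 ∧ j < lam.rowLen 0 := by
    intro i j
    constructor
    · intro hij
      have h1 := YoungDiagram.mem_iff_lt_colLen.1 (lam.up_left_mem le_rfl (Nat.zero_le j) hij)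
      obtain rfl : i = 0 := by omega
      exact ⟨rfl, YoungDiagram.mem_iff_lt_rowLen.1 hij⟩
    · rintro ⟨rfl, hj⟩
      exact YoungDiagram.mem_iff_lt_rowLen.2 hj
  ext p
  simp only [Finset.mem_image, Finset.mem_range]
  constructor
  · intro hp
    obtain ⟨i, j, rfl, hij⟩ := exists_of_mem_ferrers hp
    obtain ⟨rfl, hj⟩ := (hmem i j).1 hij
    exact ⟨j, hj, rfl⟩
  · rintro ⟨j, hj, rfl⟩
    exact mem_ferrers.2 ((hmem 0 j).2 ⟨rfl, hj⟩)

theorem ferrers_transpose (lam : YoungDiagram) :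
    ferrers lam.transpose = (ferrers lam).image Prod.swap := by
  ext ⟨r, x⟩
  simp only [Finset.mem_image, Prod.exists, Prod.swap_prod_mk, Prod.mk.injEq]
  constructor
  · intro h
    obtain ⟨i, j, h, hij⟩ := exists_of_mem_ferrers h
    simp only [Prod.mk.injEq] at h
    exact ⟨j, i, mem_ferrers.2 (YoungDiagram.mem_transpose.1 hij), h.1.symm, h.2.symm⟩
  · rintro ⟨a, b, h, rfl, rfl⟩
    obtain ⟨i, j, h, hij⟩ := exists_of_mem_ferrers h
    simp only [Prod.mk.injEq] at h
    rw [h.1, h.2]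
    exact mem_ferrers.2 (YoungDiagram.mem_transpose.2 hij)

theorem withFoundation_row {lam : YoungDiagram} (hlam : lam.rowLens.length = 1) {D : Diagram}
    {L a : ℤ} {l : ℕ} (h : HasLastRow D L a l) (hl : 0 < l) :
    withFoundation lam D 1 = attach D (rowBox L a) (lam.rowLen 0) := by
  rw [withFoundation, h.lastRow_eq hl, h.lastRowStart_eq hl, ferrers_eq_of_one_row hlam,
    Finset.image_image, attach]
  congr 2
  funext j
  simp [rowBox]

theorem withFoundation_col {lam : YoungDiagram} (hlam : lam.rowLens.length = 1) {D : Diagram}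
    {L a : ℤ} {l : ℕ} (h : HasLastRow D L a l) (hl : 0 < l) :
    withFoundation lam.transpose D 1 = attach D (colBox L a) (lam.rowLen 0) := by
  rw [withFoundation, h.lastRow_eq hl, h.lastRowStart_eq hl, ferrers_transpose,
    ferrers_eq_of_one_row hlam, Finset.image_image, Finset.image_image, attach]
  congr 2
  funext j
  simp [colBox]

/-! ### Expansions of the skew Schur functions with foundations -/

theorem skewSchur_attach_rowBox {D : Diagram} {L a : ℤ} {l m : ℕ} (h : HasLastRow D L a l)
    (hm : m ≤ l + 1) : skewSchur (attach D (rowBox L a) m) =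
      ∑ μ ∈ partitionsOf (D.card + m), (lrNum (attach D (rowBox L a) m) μ : ℤ) • schur μ := by
  rw [skewSchur_eq_sum_lrNum (h.attach_rowBox hm).ordConnected,
    card_attach (rowBox_injective L a) h.rowBox_notMem]

theorem skewSchur_attach_colBox {D : Diagram} {L a : ℤ} {l m : ℕ} (h : HasLastRow D L a l) :
    skewSchur (attach D (colBox L a) m) =
      ∑ μ ∈ partitionsOf (D.card + m), (lrNum (attach D (colBox L a) m) μ : ℤ) • schur μ := by
  rw [skewSchur_eq_sum_lrNum (h.ordConnected_attach_colBox m),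
    card_attach (colBox_injective L a) h.colBox_notMem]

theorem schurPositive_sum {P : Finset YoungDiagram} {a : YoungDiagram → ℤ}
    (h : ∀ μ ∈ P, 0 ≤ a μ) : SchurPositive (∑ μ ∈ P, a μ • schur μ) := by
  classical
  refine ⟨Finsupp.indicator P (fun μ _ => a μ), ?_, fun μ => ?_⟩
  · rw [schurSum, Finsupp.sum_of_support_subset _ (Finsupp.support_indicator_subset _ _) _
      (fun μ _ => zero_smul ℤ (schur μ))]
    exact Finset.sum_congr rfl fun μ hμ => by rw [Finsupp.indicator_of_mem hμ]
  · rw [Finsupp.indicator_apply]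
    split_ifs with hμ
    · exact h μ hμ
    · exact le_rfl

/-! ### Coefficients of a sum of fat staircases -/

theorem mem_fatStaircases {n : ℕ} {ν : YoungDiagram} :
    ν ∈ fatStaircases n ↔ ν ∈ partitionsOf n ∧ IsFatStaircase ν := by
  classical
  rw [fatStaircases, Finset.mem_filter]
  exact Iff.rfl

-- Two Schur expansions of s_D, by tableaux and by hypothesis, must agree. This shows that the
-- c^ρ_{κν} in question are nonnegative and that no other content occurs.
open Classical in
theorem IsSumOfFatStaircases.lrNum_eq {ρ κ : YoungDiagram} (h : IsSumOfFatStaircases ρ κ) :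
    ∀ ν ∈ partitionsOf (skew ρ κ).card,
      (lrNum (skew ρ κ) ν : ℤ) = if IsFatStaircase ν then lrCoeff ρ κ ν else 0 := by
  apply schur_linearIndependent
  rw [← skewSchur_eq_sum_lrNum (ordConnected_skew ρ κ), h]
  simp only [ite_smul, zero_smul]
  rw [← Finset.sum_filter]
  refine Finset.sum_congr ?_ fun _ _ => rfl
  ext ν
  rw [mem_fatStaircases, Finset.mem_filter]

open Classical in
theorem IsSumOfFatStaircases.sum_eq {ρ κ : YoungDiagram} (h : IsSumOfFatStaircases ρ κ)
    (Q : YoungDiagram → Prop) :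
    ((∑ ν ∈ partitionsOf (skew ρ κ).card, if Q ν then lrNum (skew ρ κ) ν else 0 : ℕ) : ℤ) =
      ∑ ν ∈ fatStaircases (skew ρ κ).card, lrCoeff ρ κ ν * if Q ν then 1 else 0 := by
  have hsub : fatStaircases (skew ρ κ).card ⊆ partitionsOf (skew ρ κ).card :=
    fun ν hν => (mem_fatStaircases.1 hν).1
  rw [Nat.cast_sum, ← Finset.sum_subset hsub]
  · refine Finset.sum_congr rfl fun ν hν => ?_
    rw [Nat.cast_ite, h.lrNum_eq ν (hsub hν), if_pos (mem_fatStaircases.1 hν).2]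
    split_ifs <;> simp
  · intro ν hν hn
    have hnf : ¬ IsFatStaircase ν := fun hf => hn (mem_fatStaircases.2 ⟨hν, hf⟩)
    rw [Nat.cast_ite, h.lrNum_eq ν hν, if_neg hnf]
    simp

theorem wt_le_of_isFatStaircase {D : Diagram}
    (h : ∀ ν ∈ partitionsOf D.card, lrNum D ν ≠ 0 → IsFatStaircase ν) (T : SSYT D) (hT : T.IsLR)
    (k : ℕ) : T.wt k ≤ T.wt (k + 1) + 1 := by
  obtain ⟨ν, hν, hwt⟩ := hT.exists_shape
  have hne : Nonempty (LRTab D ν) := ⟨⟨T, hT, hwt⟩⟩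
  rw [hwt, hwt]
  exact (h ν hν Nat.card_pos.ne').rowLen_le k

end

end FatStair

/-! ### Comparison of coefficients -/

open FatStair in
theorem theorem5p3 (ρ κ lam : YoungDiagram) (hκ : κ < ρ)
    (hD : FatStair.IsSumOfFatStaircases ρ κ)
    (hlam : lam.rowLens.length = 1)
    (hlen : (lam.rowLen 0 : ℤ) - 1 ≤ FatStair.lastRowLength (FatStair.skew ρ κ)) :
    FatStair.SchurGE
        (FatStair.skewSchur (FatStair.withFoundation lam.transpose (FatStair.skew ρ κ) 1)
          - FatStair.skewSchur (FatStair.withFoundation lam (FatStair.skew ρ κ) 1))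
        (∑ ν ∈ FatStair.fatStaircases (FatStair.skew ρ κ).card, FatStair.lrCoeff ρ κ ν •
          (FatStair.skewSchur
              (FatStair.withFoundation lam.transpose (FatStair.Delta (FatStair.alpha ν)) 1)
            - FatStair.skewSchur
              (FatStair.withFoundation lam (FatStair.Delta (FatStair.alpha ν)) 1))) ∧
      FatStair.SchurPositive
        (∑ ν ∈ FatStair.fatStaircases (FatStair.skew ρ κ).card, FatStair.lrCoeff ρ κ ν •
          (FatStair.skewSchur
              (FatStair.withFoundation lam.transpose (FatStair.Delta (FatStair.alpha ν)) 1)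
            - FatStair.skewSchur
              (FatStair.withFoundation lam (FatStair.Delta (FatStair.alpha ν)) 1))) ∧
      FatStair.skewSchur (FatStair.withFoundation lam.transpose (FatStair.skew ρ κ) 1)
        = ∑ ν ∈ FatStair.fatStaircases (FatStair.skew ρ κ).card, FatStair.lrCoeff ρ κ ν •
          FatStair.skewSchur
            (FatStair.withFoundation lam.transpose (FatStair.Delta (FatStair.alpha ν)) 1) := by
  classical
  set D := skew ρ κ with hDdef
  set m := lam.rowLen 0 with hm
  obtain ⟨L, a, l, hl, hrow⟩ := exists_hasLastRow (ordConnected_skew ρ κ) (skew_nonempty hκ)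
  rw [← hDdef] at hrow
  rw [hrow.lastRowLength_eq hl] at hlen
  have hml : m ≤ l + 1 := by omega
  have hcardpos : 0 < D.card := Finset.card_pos.2 (skew_nonempty hκ)
  have hfat : ∀ T : SSYT D, T.IsLR → ∀ k, T.wt k ≤ T.wt (k + 1) + 1 :=
    wt_le_of_isFatStaircase fun ν hν hne => by
      by_contra hnf
      have := hD.lrNum_eq ν hν
      rw [if_neg hnf] at this
      exact hne (by exact_mod_cast this)
  rw [withFoundation_row hlam hrow hl, withFoundation_col hlam hrow hl]
  let R : YoungDiagram → Diagram := fun ν =>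
    attach (rotate (ferrers ν)) (rowBox 0 (1 - ν.rowLen 0)) m
  let C : YoungDiagram → Diagram := fun ν =>
    attach (rotate (ferrers ν)) (colBox 0 (1 - ν.rowLen 0)) m
  have hc : ∀ ν ∈ fatStaircases D.card, lrCoeff ρ κ ν = lrNum D ν := fun ν hν => by
    rw [hD.lrNum_eq ν (mem_fatStaircases.1 hν).1, if_pos (mem_fatStaircases.1 hν).2]
  have hcard : ∀ ν ∈ fatStaircases D.card, ν.card = D.card := fun ν hν =>
    mem_partitionsOf.1 (mem_fatStaircases.1 hν).1
  -- As D is nonempty, so is each ν; the last row of its rotation is thus genuine and not the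
  -- default value for the empty diagram.
  have hpos : ∀ ν ∈ fatStaircases D.card, 0 < ν.rowLen 0 := fun ν hν => by
    by_contra h0
    have h1 := card_eq_sum_rowLen ν (n := 0) (by omega)
    rw [hcard ν hν] at h1
    simp only [Finset.range_zero, Finset.sum_empty] at h1
    omega
  have hwR : ∀ ν ∈ fatStaircases D.card, withFoundation lam (Delta (alpha ν)) 1 = R ν :=
    fun ν hν => by
      rw [Delta, delta_alpha, withFoundation_row hlam (hasLastRow_rotate_ferrers ν) (hpos ν hν)]
  have hwC : ∀ ν ∈ fatStaircases D.card, withFoundation lam.transpose (Delta (alpha ν)) 1 = C ν :=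
    fun ν hν => by
      rw [Delta, delta_alpha, withFoundation_col hlam (hasLastRow_rotate_ferrers ν) (hpos ν hν)]
  -- The first part of any content that occurs is at least the last row length l of D, so the row
  -- also fits below the rotation of ν.
  have hmν : ∀ ν ∈ fatStaircases D.card, lrNum D ν ≠ 0 → m ≤ ν.rowLen 0 + 1 := by
    intro ν hν hne
    obtain ⟨T⟩ := (Nat.card_pos_iff.1 (Nat.pos_of_ne_zero hne)).1
    have := T.2.1.le_wt_zero hrow
    rw [T.2.2] at this
    omega
  have hsC : ∀ ν ∈ fatStaircases D.card, skewSchur (C ν) =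
      ∑ μ ∈ partitionsOf (D.card + m),
        (if IsVerticalStrip μ.rowLen ν.rowLen then (1 : ℤ) else 0) • schur μ := by
    intro ν hν
    rw [skewSchur_attach_colBox (hasLastRow_rotate_ferrers ν), card_rotate, card_ferrers,
      hcard ν hν]
    refine Finset.sum_congr rfl fun μ hμ => ?_
    rw [lrNum_attach_colBox (hasLastRow_rotate_ferrers ν) (by
      rw [mem_partitionsOf.1 hμ, card_rotate, card_ferrers, hcard ν hν]),
      sum_lrNum_rotate_ferrers ν fun ν' => IsVerticalStrip μ.rowLen ν'.rowLen]
    simp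
  have hsR : ∀ ν ∈ fatStaircases D.card, lrNum D ν ≠ 0 → skewSchur (R ν) =
      ∑ μ ∈ partitionsOf (D.card + m),
        (if IsDoubleStrip μ.rowLen ν.rowLen then (1 : ℤ) else 0) • schur μ := by
    intro ν hν hne
    rw [skewSchur_attach_rowBox (hasLastRow_rotate_ferrers ν) (hmν ν hν hne), card_rotate,
      card_ferrers, hcard ν hν]
    refine Finset.sum_congr rfl fun μ hμ => ?_
    congr 1
    have hfatν : ∀ T : SSYT (rotate (ferrers ν)), T.IsLR → ∀ k, T.wt k ≤ T.wt (k + 1) + 1 := by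
      intro T hT k
      rw [hT.eq_rotTableau, wt_rotTableau, wt_rotTableau]
      exact (mem_fatStaircases.1 hν).2.rowLen_le k
    have hle := lrNum_attach_rowBox_le (hasLastRow_rotate_ferrers ν) (hmν ν hν hne) hfatν μ
    rw [sum_lrNum_rotate_ferrers ν fun ν' => IsDoubleStrip μ.rowLen ν'.rowLen] at hle
    split_ifs at hle ⊢ with hds
    · have := lrNum_attach_rowBox_pos (hmν ν hν hne)
        (by rw [mem_partitionsOf.1 hμ, hcard ν hν]) hds
      exact_mod_cast le_antisymm hle this
    · exact_mod_cast Nat.le_zero.1 hle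
  have hsum : ∑ ν ∈ fatStaircases D.card, lrCoeff ρ κ ν •
      (skewSchur (withFoundation lam.transpose (Delta (alpha ν)) 1)
        - skewSchur (withFoundation lam (Delta (alpha ν)) 1)) =
      ∑ μ ∈ partitionsOf (D.card + m), (∑ ν ∈ fatStaircases D.card, lrCoeff ρ κ ν *
        ((if IsVerticalStrip μ.rowLen ν.rowLen then 1 else 0) -
          if IsDoubleStrip μ.rowLen ν.rowLen then 1 else 0)) • schur μ := by
    simp only [Finset.sum_smul]
    rw [Finset.sum_comm]
    refine Finset.sum_congr rfl fun ν hν => ?_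
    -- When ν does not occur, the row may be too long for the rotation of ν and `hsR` is
    -- unavailable, but the coefficient vanishes.
    by_cases hne : lrNum D ν = 0
    · simp [hc ν hν, hne]
    · rw [hwR ν hν, hwC ν hν, hsC ν hν, hsR ν hν hne, ← Finset.sum_sub_distrib, Finset.smul_sum]
      refine Finset.sum_congr rfl fun μ _ => ?_
      rw [← sub_smul, smul_smul]
  have hcol : skewSchur (attach D (colBox L a) m) = ∑ μ ∈ partitionsOf (D.card + m),
      (∑ ν ∈ fatStaircases D.card, lrCoeff ρ κ ν *
        if IsVerticalStrip μ.rowLen ν.rowLen then 1 else 0) • schur μ := by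
    rw [skewSchur_attach_colBox hrow]
    refine Finset.sum_congr rfl fun μ hμ => ?_
    rw [lrNum_attach_colBox hrow (mem_partitionsOf.1 hμ),
      hD.sum_eq fun ν => IsVerticalStrip μ.rowLen ν.rowLen]
  refine ⟨?_, ?_, ?_⟩
  · rw [SchurGE, hsum, hcol, skewSchur_attach_rowBox hrow hml, ← Finset.sum_sub_distrib,
      ← Finset.sum_sub_distrib]
    simp only [← sub_smul]
    refine schurPositive_sum fun μ hμ => ?_
    -- The vertical strip terms cancel; what remains is the upper bound for the row coefficient by
    -- double strips.
    have hle := lrNum_attach_rowBox_le hrow hml hfat μ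
    have hle' : (lrNum (attach D (rowBox L a) m) μ : ℤ) ≤ _ := Nat.cast_le.2 hle
    rw [hD.sum_eq fun ν => IsDoubleStrip μ.rowLen ν.rowLen] at hle'
    simp only [mul_sub, Finset.sum_sub_distrib]
    linarith
  · rw [hsum]
    refine schurPositive_sum fun μ _ => Finset.sum_nonneg fun ν hν => ?_
    rw [hc ν hν]
    refine mul_nonneg (Nat.cast_nonneg _) ?_
    by_cases h : IsDoubleStrip μ.rowLen ν.rowLen
    · rw [if_pos h, if_pos h.1, sub_self]
    · rw [if_neg h, sub_zero]
      split_ifs <;> simp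
  · rw [hcol]
    simp only [Finset.sum_smul]
    rw [Finset.sum_comm]
    refine Finset.sum_congr rfl fun ν hν => ?_
    rw [hwC ν hν, hsC ν hν, Finset.smul_sum]
    refine Finset.sum_congr rfl fun μ _ => ?_
    rw [smul_smul]
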